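/- Let $(X_n,Y_n)_{n\ge1}$ be i.i.d. pairs of real random variables with joint density $g(s,t)$, and fix $x\in\mathbb R$. Put $f(s)=\int g(s,t)\,dt$ (the density of $X$), $a(s)=\int t\,g(s,t)\,dt$, $r(s)=\mathbb E[Y\mid X=s]=a(s)/f(s)$ and $\mathbb E[Y^2\mid X=x]=\frac1{f(x)}\int t^2g(x,t)\,dt$. Let $K:\mathbb R\to\mathbb R$, let $(h_n)_{n\ge1}$ be a sequence of positive numbers, and let $a\in(0,1)$ be a constant (not to be confused with the function $a(\cdot)$). For stepsizes $(\gamma_n),(\beta_n)$ define recursively $a_0(x)=f_0(x)=0$ and, for $n\ge1$, $$a_n(x)=(1-\beta_n)a_{n-1}(x)+\beta_nh_n^{-1}Y_nK\Big(\frac{x-X_n}{h_n}\Big),\qquad f_n(x)=(1-\gamma_n)f_{n-1}(x)+\gamma_nh_n^{-1}K\Big(\frac{x-X_n}{h_n}\Big),$$ and let $r_n(x)=a_n(x)/f_n(x)$ if $f_n(x)\ne0$, $r_n(x)=0$ otherwise. Assume: - $K$ is continuous, bounded and integrable with $\int K(z)\,dz=1$, $\int zK(z)\,dz=0$ and $\int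 z^2|K(z)|\,dz<\infty$; - $\lim_{n\to\infty}n\big(1-h_{n-1}/h_n\big)=-a$; - $s\mapsto g(s,t)$ is twice continuously differentiable for every $t$; for $q\in\{0,1,2\}$ the function $s\mapsto\int t^qg(s,t)\,dt$ is well defined, bounded and continuous at $x$; for $q\in[2,3]$ the function $s\mapsto\int|t|^qg(s,t)\,dt$ is finite and bounded; for $q\in\{0,1\}$, $\int|t|^q\big|\frac{\partial g}{\partial s}(x,t)\big|\,dt<\infty$ and $s\mapsto\int t^q\frac{\partial^2g}{\partial s^2}(s,t)\,dt$ is well defined, bounded and continuous at $x$; - $f(x)>0$, and the functions $f$ and $a$ are twice differentiable at $x$, with second derivatives $f^{(2)}(x)$ and $a^{(2)}(x)$. Write $R(K)=\int K^2(z)\,dz$, $\mu_2(K)=\int z^2K(z)\,dz$ and $$B^{(1)}_{a,\xi}(x)=\frac1{2f(x)}\left(\frac{a^{(2)}(x)}{1-2a\xi}-\frac{r(x)f^{(2)}(x)}{1-2a}\right)\mu_2(K),$$ $$V^{(1)}_{a,\xi,\beta}(x)=\left\{\frac{\mathbb E[Y^2\mid X=x]}{(2-(\beta-a)\xi)f(x)}-\left(\frac{2\xi}{1+a\xi}-\frac{\xi}{1+a}\right)\frac{r^2(x)}{f(x)}\right\}R(K).$$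 Suppose that there is $c\ge0$ such that $nh_n^5\to c$ as $n\to\infty$. (If a denominator in $B^{(1)}_{a,\xi}(x)$ vanishes, then necessarily $c=0$, and $\sqrt c\,B^{(1)}_{a,\xi}(x)$ is read as $0$.) 1. If $(\gamma_n,\beta_n)=(n^{-1},n^{-1})$, then $V^{(1)}_{a,1,1}(x)\ge0$ and $$\sqrt{nh_n}\,\big(r_n(x)-r(x)\big)\xrightarrow{\ \mathcal D\ }\mathcal N\Big(\sqrt c\,B^{(1)}_{a,1}(x),\;V^{(1)}_{a,1,1}(x)\Big).$$ 2. If $(\gamma_n,\beta_n)=(n^{-1},(1-a)n^{-1})$, then $V^{(1)}_{a,(1-a)^{-1},1}(x)\ge0$ and $$\sqrt{nh_n}\,\big(r_n(x)-r(x)\big)\xrightarrow{\ \mathcal D\ }\mathcal N\Big(\sqrt c\,B^{(1)}_{a,(1-a)^{-1}}(x),\;(1-a)\,V^{(1)}_{a,(1-a)^{-1},1}(x)\Big).$$ -/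

import Mathlib

open Filter Topology MeasureTheory ProbabilityTheory

noncomputable section

namespace SemiRec

/-- The class `GS(γ)` of regularly varying sequences `(vₙ)_{n ≥ 1}`: the sequence is positive and
`n (1 - v_{n-1} / vₙ) → γ`. The value `v 0` plays no role. -/
structure GS (γ : ℝ) (v : ℕ → ℝ) : Prop where
  pos : ∀ n : ℕ, 1 ≤ n → 0 < v n
  lim : Tendsto (fun n : ℕ => (n : ℝ) * (1 - v (n - 1) / v n)) atTop (𝓝 γ)

/-- A real function is bounded. -/
def Bdd (φ : ℝ → ℝ) : Prop := ∃ C : ℝ, ∀ s, |φ s| ≤ C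

/-- The assumption on the kernel: continuous, bounded, with integral one, first moment zero and
finite second moment. -/
structure KernelAssumption (K : ℝ → ℝ) : Prop where
  cont : Continuous K
  bdd : Bdd K
  integrable : Integrable K
  integral_eq_one : ∫ z, K z = 1
  integral_mul_eq_zero : ∫ z, z * K z = 0
  integrable_sq : Integrable (fun z => z ^ 2 * K z)

/-- `∫ t ^ q g(s, t) dt`, as a function of `s`. -/
def moment (g : ℝ → ℝ → ℝ) (q : ℕ) (s : ℝ) : ℝ := ∫ t, t ^ q * g s t

/-- The second partial derivative `∂²g / ∂s² (s, t)`. -/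
def dss (g : ℝ → ℝ → ℝ) (s t : ℝ) : ℝ := iteratedDeriv 2 (fun u => g u t) s

/-- The assumption on the joint density `g` at the point `x`: smoothness in the first variable,
and boundedness and continuity of moments (which includes that the integrals exist). -/
structure DensityAssumption (g : ℝ → ℝ → ℝ) (x : ℝ) : Prop where
  contDiff : ∀ t, ContDiff ℝ 2 (fun s => g s t)
  moment_integrable : ∀ q : ℕ, q ≤ 2 → ∀ s, Integrable (fun t => t ^ q * g s t)
  moment_bdd : ∀ q : ℕ, q ≤ 2 → Bdd (moment g q)
  moment_cont : ∀ q : ℕ, q ≤ 2 → ContinuousAt (moment g q) x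
  absMoment_integrable : ∀ q : ℝ, q ∈ Set.Icc 2 3 → ∀ s, Integrable (fun t => |t| ^ q * g s t)
  absMoment_bdd : ∀ q : ℝ, q ∈ Set.Icc 2 3 → Bdd (fun s => ∫ t, |t| ^ q * g s t)
  deriv_integrable : ∀ q : ℕ, q ≤ 1 → Integrable (fun t => |t| ^ q * |deriv (fun s => g s t) x|)
  deriv2_integrable : ∀ q : ℕ, q ≤ 1 → ∀ s, Integrable (fun t => t ^ q * dss g s t)
  deriv2_bdd : ∀ q : ℕ, q ≤ 1 → Bdd (fun s => ∫ t, t ^ q * dss g s t)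
  deriv2_cont : ∀ q : ℕ, q ≤ 1 → ContinuousAt (fun s => ∫ t, t ^ q * dss g s t) x

/-- `φ` is twice differentiable at `x`: it is differentiable near `x` and its derivative is
differentiable at `x`. -/
def TwiceDiffAt (φ : ℝ → ℝ) (x : ℝ) : Prop :=
  (∀ᶠ s in 𝓝 x, DifferentiableAt ℝ φ s) ∧ DifferentiableAt ℝ (deriv φ) x

/-- The density `f` of `X`. -/
def dens (g : ℝ → ℝ → ℝ) : ℝ → ℝ := moment g 0

/-- The conditional moment `E[Y ^ q | X = x] = ∫ t ^ q g(x, t) dt / f(x)`. -/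
def condMoment (g : ℝ → ℝ → ℝ) (q : ℕ) (x : ℝ) : ℝ := moment g q x / dens g x

/-- The regression function `r(x) = E[Y | X = x]`. -/
def regr (g : ℝ → ℝ → ℝ) (x : ℝ) : ℝ := condMoment g 1 x

/-- The function `a(x) = E[Y | X = x] f(x) = ∫ t g(x, t) dt`. -/
def regrDens (g : ℝ → ℝ → ℝ) : ℝ → ℝ := moment g 1

/-- `R(K) = ∫ K(z)² dz`. -/
def kerR (K : ℝ → ℝ) : ℝ := ∫ z, K z ^ 2

/-- `μ_j(K) = ∫ z ^ j K(z) dz`. -/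
def kerMu (j : ℕ) (K : ℝ → ℝ) : ℝ := ∫ z, z ^ j * K z

/-- The bias constant `B⁽¹⁾_{a,ξ}(x)`. -/
def biasB (g : ℝ → ℝ → ℝ) (K : ℝ → ℝ) (a ξ x : ℝ) : ℝ :=
  1 / (2 * dens g x) *
    (iteratedDeriv 2 (regrDens g) x / (1 - 2 * a * ξ)
      - regr g x * iteratedDeriv 2 (dens g) x / (1 - 2 * a)) * kerMu 2 K

/-- The variance constant `V⁽¹⁾_{a,ξ,β}(x)`. -/
def varV (g : ℝ → ℝ → ℝ) (K : ℝ → ℝ) (a ξ β x : ℝ) : ℝ :=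
  (condMoment g 2 x / ((2 - (β - a) * ξ) * dens g x)
    - (2 * ξ / (1 + a * ξ) - ξ / (1 + a)) * (regr g x ^ 2 / dens g x)) * kerR K

section Estimators

variable {Ω : Type*} (K : ℝ → ℝ) (h : ℕ → ℝ) (X Y : ℕ → Ω → ℝ) (x : ℝ)

/-- The recursive estimator `aₙ(x)` with stepsize `β` and `a₀(x) = 0`. -/
def estA (β : ℕ → ℝ) : ℕ → Ω → ℝ
  | 0, _ => 0
  | n + 1, ω => (1 - β (n + 1)) * estA β n ω
      + β (n + 1) * (h (n + 1))⁻¹ * Y (n + 1) ω * K ((h (n + 1))⁻¹ * (x - X (n + 1) ω))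

/-- The recursive density estimator `fₙ(x)` with stepsize `γ` and `f₀(x) = 0`. -/
def estF (γ : ℕ → ℝ) : ℕ → Ω → ℝ
  | 0, _ => 0
  | n + 1, ω => (1 - γ (n + 1)) * estF γ n ω
      + γ (n + 1) * (h (n + 1))⁻¹ * K ((h (n + 1))⁻¹ * (x - X (n + 1) ω))

open Classical in
/-- The semi-recursive regression estimator `rₙ(x)` with stepsizes `(γ, β)`. -/
def estR (γ β : ℕ → ℝ) (n : ℕ) (ω : Ω) : ℝ :=
  if estF K h X x γ n ω ≠ 0 then estA K h X Y x β n ω / estF K h X x γ n ω else 0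

end Estimators

end SemiRec

end

/-! Write `r_n - r = (a_n - r f_n) / f_n` with `r = r(x)`. For stepsizes `b / n` and `1 / n` the
recursions unroll into weighted sums, so `√(n h_n) (a_n - r f_n)` is the sum of one row of a
triangular array of independent variables. A Lyapunov theorem
(`tendstoInDistribution_sum_of_lyapunov`) gives its Gaussian limit, a weak law gives `f_n → f(x)` in
probability, and Slutsky (`tendstoInDistribution_div`) handles the quotient.

The Lyapunov theorem is stated without centring: it asks for the limits of the summed first and
second moments, and for the summed third absolute moments and squared first absolute moments to
vanish. The bias thus appears as the limit of the means. The moments come from the change of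
variables `E[φ(Y) L((x - X) / H)] = H ∫ L(z) m(x - H z) dz` with `m(s) = ∫ φ(t) g(s, t) dt`,
followed by continuity of `m` (second moments) or a second order Taylor expansion (means,
`tendsto_smooth_bias`).

Every sum over a row has the form `S_n = ∑ w_{n,k} e_k`, where passing from row `n` to row `n + 1`
multiplies old weights by a common `ρ_n = 1 - A / n + o(1 / n)`. Hence `S_{n+1} = ρ_n S_n +
w_{n+1,n} e_n`, and `S_n → β / A` when `A > 0` and `n w_{n+1,n} e_n → β` (`IsDecay.tendsto_sum`).
The exponents `A` add under products, with value `b` for the averaging weights, `a` for `h_n` and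
`-1` for `n`. The condition `1 - a < 2 b` makes all exponents needed positive; it holds for `b = 1`
and `b = 1 - a`.

The mean obtained this way has denominators different from those of `biasB`. They agree because `c ≠
0` forces `a = 1 / 5` (`Bandwidth.eq_one_fifth`), while both means vanish for `c = 0`. -/

noncomputable section

namespace SemiRec

/-! ### Affine recursions with steps of order `1 / n` -/

/-- A nonnegative sequence contracted by factors `1 - A / n` tends to zero. -/
lemma tendsto_zero_of_le_one_sub_div_mul {A : ℝ} (hA : 0 < A) {D : ℕ → ℝ} (hD : ∀ n, 0 ≤ D n)
    (h : ∀ᶠ n : ℕ in atTop, D (n + 1) ≤ (1 - A / ((n : ℝ) + 1)) * D n) :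
    Tendsto D atTop (𝓝 0) := by
  obtain ⟨N, hN⟩ := eventually_atTop.1 h
  -- Since `1 - u ≤ exp (-u)`, the contraction factors multiply to the exponential of a harmonic
  -- sum, which diverges.
  have key : ∀ m, D (N + m) ≤
      Real.exp (-(A * ∑ j ∈ Finset.range m, 1 / (((N + j : ℕ) : ℝ) + 1))) * D N := by
    intro m
    induction m with
    | zero => simp
    | succ m ih =>
      have h1 := hN (N + m) (by omega)
      have h2 : 1 - A / (((N + m : ℕ) : ℝ) + 1) ≤ Real.exp (-(A / (((N + m : ℕ) : ℝ) + 1))) := by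
        have := Real.add_one_le_exp (-(A / (((N + m : ℕ) : ℝ) + 1)))
        linarith
      calc D (N + (m + 1)) ≤ (1 - A / (((N + m : ℕ) : ℝ) + 1)) * D (N + m) := h1
        _ ≤ Real.exp (-(A / (((N + m : ℕ) : ℝ) + 1))) * D (N + m) := by
          gcongr; exact hD _
        _ ≤ Real.exp (-(A / (((N + m : ℕ) : ℝ) + 1))) *
            (Real.exp (-(A * ∑ j ∈ Finset.range m, 1 / (((N + j : ℕ) : ℝ) + 1))) * D N) := by
          gcongr
        _ = _ := by
          rw [← mul_assoc, ← Real.exp_add, Finset.sum_range_succ]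
          congr 2
          ring
  have hsum : Tendsto (fun m : ℕ => ∑ j ∈ Finset.range m, 1 / (((N + j : ℕ) : ℝ) + 1))
      atTop atTop := by
    have h0 : ¬ Summable (fun j : ℕ => 1 / (((N + j : ℕ) : ℝ) + 1)) := by
      intro hs
      apply Real.not_summable_one_div_natCast
      refine (summable_nat_add_iff (N + 1)).1 (hs.congr fun j => ?_)
      push_cast
      ring_nf
    exact (not_summable_iff_tendsto_nat_atTop_of_nonneg (fun j => by positivity)).1 h0
  have hlim : Tendsto (fun m => Real.exp
      (-(A * ∑ j ∈ Finset.range m, 1 / (((N + j : ℕ) : ℝ) + 1))) * D N) atTop (𝓝 0) := by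
    have := (Real.tendsto_exp_neg_atTop_nhds_zero.comp (hsum.const_mul_atTop hA)).mul_const (D N)
    simpa using this
  have h3 : Tendsto (fun m => D (m + N)) atTop (𝓝 0) :=
    squeeze_zero (fun m => hD _) (fun m => by rw [add_comm]; exact key m) hlim
  exact (tendsto_add_atTop_iff_nat N).1 h3

/-- The limit of a sequence given by an affine recursion with steps of order `1 / n`. -/
lemma tendsto_of_affine_recursion {S ρ B : ℕ → ℝ} {A β : ℝ} (hA : 0 < A)
    (hS : ∀ᶠ n : ℕ in atTop, S (n + 1) = ρ n * S n + B n)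
    (hρ : Tendsto (fun n : ℕ => ((n : ℝ) + 1) * (1 - ρ n)) atTop (𝓝 A))
    (hB : Tendsto (fun n : ℕ => ((n : ℝ) + 1) * B n) atTop (𝓝 β)) :
    Tendsto S atTop (𝓝 (β / A)) := by
  -- After recentring at the fixed point `β / A`, the forcing term is `o(1 / n)`.
  have hC : Tendsto (fun n : ℕ => ((n : ℝ) + 1) * (B n - (1 - ρ n) * (β / A))) atTop (𝓝 0) := by
    have := hB.sub (hρ.mul_const (β / A))
    have h0 : β - A * (β / A) = 0 := by field_simp; simp
    rw [h0] at this
    exact this.congr fun n => by ring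
  rw [Metric.tendsto_atTop']
  intro ε hε
  -- Giving up half of the rate `A` lets the forcing term be absorbed by the margin `ε / 2`, so the
  -- excess over `ε / 2` is purely contracted.
  have hpos : Tendsto (fun n => max (|S n - β / A| - ε / 2) 0) atTop (𝓝 0) := by
    refine tendsto_zero_of_le_one_sub_div_mul (half_pos hA) (fun n => le_max_right _ _) ?_
    have e1 := hρ.eventually (Ioo_mem_nhds (show A / 2 < A by linarith) (lt_add_one A))
    have e2 := hC.eventually (Ioo_mem_nhds (show -(A / 2 * (ε / 2)) < 0 by
      have := mul_pos (half_pos hA) (half_pos hε); linarith) (mul_pos (half_pos hA) (half_pos hε)))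
    have e3 : ∀ᶠ n : ℕ in atTop, A + 1 ≤ (n : ℝ) :=
      tendsto_natCast_atTop_atTop.eventually_ge_atTop _
    filter_upwards [hS, e1, e2, e3] with n hn h1 h2 h3
    have hn1 : (0 : ℝ) < (n : ℝ) + 1 := by positivity
    have hr1 : ρ n ≤ 1 - A / 2 / ((n : ℝ) + 1) := by
      have : A / 2 / ((n : ℝ) + 1) ≤ 1 - ρ n := by
        rw [div_le_iff₀ hn1]; linarith [h1.1]
      linarith
    have hr0 : 0 ≤ ρ n := by
      have : 1 - ρ n ≤ 1 := by
        by_contra! hcon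
        have := h1.2
        nlinarith
      linarith
    have hb : |B n - (1 - ρ n) * (β / A)| ≤ A / 2 / ((n : ℝ) + 1) * (ε / 2) := by
      have : A / 2 / ((n : ℝ) + 1) * (ε / 2) = (A / 2 * (ε / 2)) / ((n : ℝ) + 1) := by ring
      rw [this, le_div_iff₀ hn1, mul_comm]
      nth_rewrite 1 [← abs_of_pos hn1]
      rw [← abs_mul, abs_le]
      exact ⟨h2.1.le, h2.2.le⟩
    have hstep : |S (n + 1) - β / A| ≤
        (1 - A / 2 / ((n : ℝ) + 1)) * |S n - β / A| + A / 2 / ((n : ℝ) + 1) * (ε / 2) := by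
      have : S (n + 1) - β / A = ρ n * (S n - β / A) + (B n - (1 - ρ n) * (β / A)) := by
        rw [hn]; ring
      rw [this]
      refine (abs_add_le _ _).trans (add_le_add ?_ hb)
      rw [abs_mul, abs_of_nonneg hr0]
      gcongr
    have hq : 0 ≤ 1 - A / 2 / ((n : ℝ) + 1) := hr0.trans hr1
    refine max_le ?_ (mul_nonneg hq (le_max_right _ _))
    calc |S (n + 1) - β / A| - ε / 2
        ≤ (1 - A / 2 / ((n : ℝ) + 1)) * (|S n - β / A| - ε / 2) := by linarith
      _ ≤ _ := by gcongr; exact le_max_left _ _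
  have h4 := hpos.eventually (gt_mem_nhds (half_pos hε))
  obtain ⟨N, hN⟩ := eventually_atTop.1 h4
  refine ⟨N, fun n hn => ?_⟩
  have h5 := (le_max_left _ _).trans_lt (hN n hn.le)
  rw [Real.dist_eq]
  linarith

/-! ### Calculus of decay exponents -/

/-- A triangular array of weights whose `n`-th row is proportional to the previous one, with ratio
`1 - A / n + o(1 / n)`. -/
def IsDecay (w : ℕ → ℕ → ℝ) (A : ℝ) : Prop :=
  ∃ ρ : ℕ → ℝ, (∀ᶠ n : ℕ in atTop, 0 ≤ ρ n ∧ ∀ k < n, w (n + 1) k = ρ n * w n k) ∧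
    Tendsto (fun n : ℕ => ((n : ℝ) + 1) * (1 - ρ n)) atTop (𝓝 A)

lemma tendsto_one_of_tendsto_mul_one_sub {ρ : ℕ → ℝ} {A : ℝ}
    (h : Tendsto (fun n : ℕ => ((n : ℝ) + 1) * (1 - ρ n)) atTop (𝓝 A)) :
    Tendsto ρ atTop (𝓝 1) := by
  have := (h.mul tendsto_one_div_add_atTop_nhds_zero_nat).const_sub 1
  simp only [mul_zero, sub_zero] at this
  refine this.congr fun n => ?_
  have : (n : ℝ) + 1 ≠ 0 := by positivity
  field_simp
  ring

/-- Exponents add because `1 - ρ ρ' = (1 - ρ) + ρ (1 - ρ')` and `ρ → 1`. -/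
lemma IsDecay.mul {w w' : ℕ → ℕ → ℝ} {A A' : ℝ} (h : IsDecay w A) (h' : IsDecay w' A') :
    IsDecay (fun n k => w n k * w' n k) (A + A') := by
  obtain ⟨ρ, h1, h2⟩ := h
  obtain ⟨ρ', h1', h2'⟩ := h'
  refine ⟨fun n => ρ n * ρ' n, ?_, ?_⟩
  · filter_upwards [h1, h1'] with n hn hn'
    exact ⟨mul_nonneg hn.1 hn'.1, fun k hk => by rw [hn.2 k hk, hn'.2 k hk]; ring⟩
  · have := h2.add ((tendsto_one_of_tendsto_mul_one_sub h2).mul h2')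
    rw [one_mul] at this
    exact this.congr fun n => by ring

lemma IsDecay.pow {w : ℕ → ℕ → ℝ} {A : ℝ} (h : IsDecay w A) (m : ℕ) :
    IsDecay (fun n k => w n k ^ m) (m * A) := by
  induction m with
  | zero =>
    refine ⟨fun _ => 1, Eventually.of_forall fun n => ⟨zero_le_one, by simp⟩, by simp⟩
  | succ m ih =>
    have := ih.mul h
    simp_rw [pow_succ]
    rwa [show ((m + 1 : ℕ) : ℝ) * A = m * A + A by push_cast; ring]

/-- The exponent halves because `1 - √ρ = (1 - ρ) / (1 + √ρ)`, with denominator tending to `2`. -/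
lemma IsDecay.sqrt {w : ℕ → ℕ → ℝ} {A : ℝ} (h : IsDecay w A) :
    IsDecay (fun n k => √(w n k)) (A / 2) := by
  obtain ⟨ρ, h1, h2⟩ := h
  refine ⟨fun n => √(ρ n), ?_, ?_⟩
  · filter_upwards [h1] with n hn
    exact ⟨Real.sqrt_nonneg _, fun k hk => by rw [hn.2 k hk, Real.sqrt_mul hn.1]⟩
  · have h3 : Tendsto (fun n => 1 + √(ρ n)) atTop (𝓝 2) := by
      have := ((Real.continuous_sqrt.tendsto 1).comp
        (tendsto_one_of_tendsto_mul_one_sub h2)).const_add 1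
      rw [Real.sqrt_one] at this
      norm_num at this
      exact this
    refine (h2.div h3 two_ne_zero).congr' ?_
    filter_upwards [h1] with n hn
    have : 1 + √(ρ n) ≠ 0 := by positivity
    simp only [Pi.div_apply]
    rw [div_eq_iff this]
    nlinarith [Real.sq_sqrt hn.1]

/-- Splitting off the newest term, the diagonal entry `w (n + 1) n`, leaves the old sum multiplied
by `ρ n`: an affine recursion. This computes all the row sums below. -/
lemma IsDecay.tendsto_sum {w : ℕ → ℕ → ℝ} {A β : ℝ} (h : IsDecay w A) (hA : 0 < A) {e : ℕ → ℝ}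
    (hβ : Tendsto (fun n : ℕ => ((n : ℝ) + 1) * (w (n + 1) n * e n)) atTop (𝓝 β)) :
    Tendsto (fun n => ∑ k ∈ Finset.range n, w n k * e k) atTop (𝓝 (β / A)) := by
  obtain ⟨ρ, h1, h2⟩ := h
  refine tendsto_of_affine_recursion hA ?_ h2 hβ
  filter_upwards [h1] with n hn
  rw [Finset.sum_range_succ, Finset.mul_sum]
  congr 1
  refine Finset.sum_congr rfl fun k hk => ?_
  rw [hn.2 k (Finset.mem_range.1 hk)]
  ring

lemma IsDecay.tendsto_zero {v : ℕ → ℝ} {A : ℝ} (h : IsDecay (fun n _ => v n) A) (hA : 0 < A) :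
    Tendsto v atTop (𝓝 0) := by
  obtain ⟨ρ, h1, h2⟩ := h
  have := tendsto_of_affine_recursion (S := v) (B := fun _ => 0) (β := 0) hA ?_ h2 (by simp)
  · simpa using this
  · filter_upwards [h1, eventually_gt_atTop 0] with n hn h0
    rw [hn.2 0 h0, add_zero]

lemma IsDecay.inv {w : ℕ → ℕ → ℝ} {A : ℝ} (h : IsDecay w A) :
    IsDecay (fun n k => (w n k)⁻¹) (-A) := by
  obtain ⟨ρ, h1, h2⟩ := h
  refine ⟨fun n => (ρ n)⁻¹, ?_, ?_⟩
  · filter_upwards [h1] with n hn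
    exact ⟨inv_nonneg.2 hn.1, fun k hk => by rw [hn.2 k hk, mul_inv]⟩
  · have hρ := tendsto_one_of_tendsto_mul_one_sub h2
    have := (h2.div hρ one_ne_zero).neg
    rw [div_one] at this
    refine this.congr' ?_
    filter_upwards [hρ.eventually_ne one_ne_zero] with n hn
    simp only [Pi.div_apply]
    field_simp
    ring

/-- The ratio `v n / v (n + 1)` in the definition of `GS` is the row factor of `v⁻¹`, so the
exponent is read off there and its sign reversed by inversion. -/
lemma GS.isDecay {v : ℕ → ℝ} {γ : ℝ} (h : GS γ v) : IsDecay (fun n _ => v n) (-γ) := by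
  have h1 : Tendsto (fun n : ℕ => ((n : ℝ) + 1) * (1 - v n / v (n + 1))) atTop (𝓝 γ) := by
    have := (tendsto_add_atTop_iff_nat 1).2 h.lim
    simpa using this
  have h2 : IsDecay (fun n _ => (v n)⁻¹) γ := by
    refine ⟨fun n => v n / v (n + 1), ?_, h1⟩
    filter_upwards [eventually_ge_atTop 1] with n hn
    have p := h.pos n hn
    have p' := h.pos (n + 1) (by omega)
    exact ⟨by positivity, fun k _ => by field_simp⟩
  simpa using h2.inv

lemma isDecay_natCast : IsDecay (fun n _ => (n : ℝ)) (-1) := by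
  refine ⟨fun n => ((n : ℝ) + 1) / n, ?_, ?_⟩
  · filter_upwards [eventually_ge_atTop 1] with n hn
    have : (0 : ℝ) < n := by exact_mod_cast hn
    exact ⟨by positivity, fun k _ => by push_cast; field_simp⟩
  · have : Tendsto (fun n : ℕ => -((1 : ℝ) + (n : ℝ)⁻¹)) atTop (𝓝 (-(1 + 0))) :=
      (tendsto_inv_atTop_nhds_zero_nat.const_add 1).neg
    rw [add_zero] at this
    refine this.congr' ?_
    filter_upwards [eventually_ge_atTop 1] with n hn
    have : (n : ℝ) ≠ 0 := by positivity
    field_simp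
    ring

/-! ### Weights of the recursive averages -/

/-- The weight of the observation `k + 1` in the `n`-th recursive average with stepsizes `b / n`. -/
def wt (b : ℝ) (n k : ℕ) : ℝ :=
  b / ((k : ℝ) + 1) * ∏ j ∈ Finset.Ico (k + 1) n, (1 - b / ((j : ℝ) + 1))

lemma wt_self (b : ℝ) (n : ℕ) : wt b (n + 1) n = b / ((n : ℝ) + 1) := by simp [wt]

lemma wt_succ (b : ℝ) {n k : ℕ} (hk : k < n) :
    wt b (n + 1) k = (1 - b / ((n : ℝ) + 1)) * wt b n k := by
  rw [wt, wt, Finset.prod_Ico_succ_top (by omega)]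
  ring

lemma wt_nonneg {b : ℝ} (hb0 : 0 ≤ b) (hb1 : b ≤ 1) (n k : ℕ) : 0 ≤ wt b n k := by
  refine mul_nonneg (by positivity) (Finset.prod_nonneg fun j _ => ?_)
  have : b / ((j : ℝ) + 1) ≤ 1 := by
    rw [div_le_one (by positivity)]
    have : (0 : ℝ) ≤ j := Nat.cast_nonneg j
    linarith
  linarith

lemma isDecay_wt (b : ℝ) : IsDecay (wt b) b := by
  refine ⟨fun n => 1 - b / ((n : ℝ) + 1), ?_, ?_⟩
  · filter_upwards [tendsto_natCast_atTop_atTop.eventually_ge_atTop b] with n hn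
    refine ⟨?_, fun k hk => wt_succ b hk⟩
    rw [sub_nonneg, div_le_one (by positivity)]
    linarith
  · refine tendsto_const_nhds.congr fun n => ?_
    have : (n : ℝ) + 1 ≠ 0 := by positivity
    field_simp
    ring

/-- The weights need not sum to `1`; the missing mass is the product that still multiplies the
initial value. It enters the bias and must be shown negligible at scale `√(n h_n)`. -/
lemma sum_wt_eq (b : ℝ) (n : ℕ) :
    ∑ k ∈ Finset.range n, wt b n k = 1 - ∏ j ∈ Finset.range n, (1 - b / ((j : ℝ) + 1)) := by
  induction n with
  | zero => simp
  | succ n ih =>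
    rw [Finset.sum_range_succ, wt_self,
      Finset.sum_congr rfl fun k hk => wt_succ b (Finset.mem_range.1 hk), ← Finset.mul_sum, ih,
      Finset.prod_range_succ]
    ring

lemma isDecay_prod (b : ℝ) :
    IsDecay (fun n _ => ∏ j ∈ Finset.range n, (1 - b / ((j : ℝ) + 1))) b := by
  refine ⟨fun n => 1 - b / ((n : ℝ) + 1), ?_, ?_⟩
  · filter_upwards [tendsto_natCast_atTop_atTop.eventually_ge_atTop b] with n hn
    refine ⟨?_, fun k _ => by rw [Finset.prod_range_succ, mul_comm]⟩
    rw [sub_nonneg, div_le_one (by positivity)]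
    linarith
  · refine tendsto_const_nhds.congr fun n => ?_
    have : (n : ℝ) + 1 ≠ 0 := by positivity
    field_simp
    ring

section Estimators

variable {Ω : Type*} (K : ℝ → ℝ) (h : ℕ → ℝ) (X Y : ℕ → Ω → ℝ) (x : ℝ)

lemma estA_eq_sum (b : ℝ) (n : ℕ) (ω : Ω) :
    estA K h X Y x (fun n => b * (n : ℝ)⁻¹) n ω = ∑ k ∈ Finset.range n, wt b n k *
      ((h (k + 1))⁻¹ * Y (k + 1) ω * K ((h (k + 1))⁻¹ * (x - X (k + 1) ω))) := by
  induction n with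
  | zero => simp [estA]
  | succ n ih =>
    rw [estA, ih, Finset.sum_range_succ, wt_self, Finset.mul_sum]
    congr 1
    · refine Finset.sum_congr rfl fun k hk => ?_
      rw [wt_succ b (Finset.mem_range.1 hk)]
      push_cast
      ring
    · push_cast
      ring

lemma estF_eq_sum (n : ℕ) (ω : Ω) :
    estF K h X x (fun n => (n : ℝ)⁻¹) n ω = ∑ k ∈ Finset.range n, wt 1 n k *
      ((h (k + 1))⁻¹ * K ((h (k + 1))⁻¹ * (x - X (k + 1) ω))) := by
  induction n with
  | zero => simp [estF]
  | succ n ih =>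
    rw [estF, ih, Finset.sum_range_succ, wt_self, Finset.mul_sum]
    congr 1
    · refine Finset.sum_congr rfl fun k hk => ?_
      rw [wt_succ 1 (Finset.mem_range.1 hk)]
      push_cast
      ring
    · push_cast
      ring

end Estimators

/-! ### Characteristic functions and the Lyapunov theorem -/

/-- The Taylor bound for `|y| ≤ 1`, and domination of every term by `|y| ^ 3` for `|y| > 1`. Being
global, it can be integrated without truncation. -/
lemma norm_exp_mul_I_sub_quadratic_le (y : ℝ) :
    ‖Complex.exp (y * Complex.I) - (1 + y * Complex.I - (y : ℂ) ^ 2 / 2)‖ ≤ 4 * |y| ^ 3 := by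
  rcases le_or_gt |y| 1 with hy | hy
  · have hn : ‖(y : ℂ) * Complex.I‖ = |y| := by simp
    have := Complex.exp_bound (x := (y : ℂ) * Complex.I) (by rw [hn]; exact hy)
      (show 0 < 3 by norm_num)
    rw [hn] at this
    have e : ∑ m ∈ Finset.range 3, ((y : ℂ) * Complex.I) ^ m / (m.factorial : ℂ) =
        1 + y * Complex.I - (y : ℂ) ^ 2 / 2 := by
      simp [Finset.sum_range_succ, mul_pow, Nat.factorial]
      ring
    rw [e] at this
    refine this.trans ?_
    rw [mul_comm]
    gcongr
    norm_num [Nat.factorial]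
  · have h1 : ‖Complex.exp (y * Complex.I)‖ = 1 := Complex.norm_exp_ofReal_mul_I y
    have h2 : ‖(1 : ℂ) + y * Complex.I - (y : ℂ) ^ 2 / 2‖ ≤ 1 + |y| + |y| ^ 2 / 2 := by
      refine (norm_sub_le _ _).trans (add_le_add ((norm_add_le _ _).trans ?_) ?_)
      · simp
      · simp
    refine (norm_sub_le _ _).trans ?_
    rw [h1]
    have h3 : |y| ^ 2 ≤ |y| ^ 3 := pow_le_pow_right₀ hy.le (by norm_num)
    have h4 : |y| ≤ |y| ^ 3 := le_self_pow₀ hy.le (by norm_num)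
    have h5 : 1 ≤ |y| ^ 3 := one_le_pow₀ hy.le
    linarith

/-- Products of complex factors close to `1`. -/
lemma tendsto_prod_one_add_exp {z : ℕ → ℕ → ℂ} {L : ℂ}
    (h1 : Tendsto (fun n => ∑ k ∈ Finset.range n, z n k) atTop (𝓝 L))
    (h2 : Tendsto (fun n => ∑ k ∈ Finset.range n, ‖z n k‖ ^ 2) atTop (𝓝 0)) :
    Tendsto (fun n => ∏ k ∈ Finset.range n, (1 + z n k)) atTop (𝓝 (Complex.exp L)) := by
  have hsmall : ∀ᶠ n in atTop, ∀ k ∈ Finset.range n, ‖z n k‖ ≤ 1 / 2 := by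
    filter_upwards [h2.eventually (gt_mem_nhds (show (0 : ℝ) < 1 / 4 by norm_num))] with n hn k hk
    have : ‖z n k‖ ^ 2 ≤ ∑ k ∈ Finset.range n, ‖z n k‖ ^ 2 :=
      Finset.single_le_sum (f := fun k => ‖z n k‖ ^ 2) (fun _ _ => by positivity) hk
    nlinarith [norm_nonneg (z n k)]
  -- For `‖z‖ ≤ 1 / 2` one has `‖log (1 + z) - z‖ ≤ ‖z‖ ^ 2`, so the sum of logarithms has the same
  -- limit as the sum of the `z n k`.
  have hlog : Tendsto (fun n => ∑ k ∈ Finset.range n, Complex.log (1 + z n k)) atTop (𝓝 L) := by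
    have : Tendsto (fun n => ∑ k ∈ Finset.range n, (Complex.log (1 + z n k) - z n k)) atTop
        (𝓝 0) := by
      refine squeeze_zero_norm' ?_ h2
      filter_upwards [hsmall] with n hn
      refine (norm_sum_le _ _).trans (Finset.sum_le_sum fun k hk => ?_)
      have hz := hn k hk
      refine (Complex.norm_log_one_add_sub_self_le (by linarith)).trans ?_
      have : (1 - ‖z n k‖)⁻¹ ≤ 2 := by
        rw [inv_le_comm₀ (by linarith) (by norm_num)]
        linarith
      nlinarith [sq_nonneg ‖z n k‖]
    have h3 := this.add h1
    rw [zero_add] at h3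
    refine h3.congr fun n => ?_
    rw [← Finset.sum_add_distrib]
    exact Finset.sum_congr rfl fun k _ => by ring
  refine ((Complex.continuous_exp.tendsto L).comp hlog).congr' ?_
  filter_upwards [hsmall] with n hn
  simp only [Function.comp_apply]
  rw [Complex.exp_sum]
  refine Finset.prod_congr rfl fun k hk => Complex.exp_log fun h0 => ?_
  have hz := hn k hk
  have : z n k = -1 := by linear_combination h0
  rw [this] at hz
  norm_num at hz

lemma integrable_of_integrable_abs_pow_three {Ω : Type*} [MeasurableSpace Ω] {P : Measure Ω}
    [IsProbabilityMeasure P] {ξ : Ω → ℝ} (hm : AEMeasurable ξ P)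
    (h3 : Integrable (fun ω => |ξ ω| ^ 3) P) :
    Integrable ξ P ∧ Integrable (fun ω => ξ ω ^ 2) P := by
  constructor
  · refine ((integrable_const (1 : ℝ)).add h3).mono' hm.aestronglyMeasurable
      (Eventually.of_forall fun ω => ?_)
    simp only [Real.norm_eq_abs, Pi.add_apply]
    rcases le_or_gt |ξ ω| 1 with h | h
    · have : 0 ≤ |ξ ω| ^ 3 := by positivity
      linarith
    · have : |ξ ω| ≤ |ξ ω| ^ 3 := le_self_pow₀ h.le (by norm_num)
      linarith
  · refine ((integrable_const (1 : ℝ)).add h3).mono' (hm.pow_const 2).aestronglyMeasurable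
      (Eventually.of_forall fun ω => ?_)
    simp only [Real.norm_eq_abs, Pi.add_apply, abs_pow]
    rcases le_or_gt |ξ ω| 1 with h | h
    · have : 0 ≤ |ξ ω| ^ 3 := by positivity
      have : |ξ ω| ^ 2 ≤ 1 := pow_le_one₀ (abs_nonneg _) h
      linarith
    · have : |ξ ω| ^ 2 ≤ |ξ ω| ^ 3 := pow_le_pow_right₀ h.le (by norm_num)
      linarith

lemma integrable_exp_mul_I {Ω : Type*} [MeasurableSpace Ω] {P : Measure Ω}
    [IsProbabilityMeasure P] {ξ : Ω → ℝ} (hm : AEMeasurable ξ P) :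
    Integrable (fun ω => Complex.exp ((ξ ω : ℂ) * Complex.I)) P := by
  refine Integrable.of_bound (C := 1) ?_ (Eventually.of_forall fun ω => ?_)
  · have : Measurable fun y : ℝ => Complex.exp ((y : ℂ) * Complex.I) := by fun_prop
    exact (this.comp_aemeasurable hm).aestronglyMeasurable
  · rw [Complex.norm_exp_ofReal_mul_I]

lemma norm_charFun_sub_quadratic_le {Ω : Type*} [MeasurableSpace Ω] {P : Measure Ω}
    [IsProbabilityMeasure P] {ξ : Ω → ℝ} (hm : AEMeasurable ξ P)
    (h3 : Integrable (fun ω => |ξ ω| ^ 3) P) (t : ℝ) :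
    ‖charFun (P.map ξ) t - 1 - (t * (∫ ω, ξ ω ∂P) * Complex.I - t ^ 2 * (∫ ω, ξ ω ^ 2 ∂P) / 2)‖
      ≤ 4 * |t| ^ 3 * ∫ ω, |ξ ω| ^ 3 ∂P := by
  obtain ⟨i1, i2⟩ := integrable_of_integrable_abs_pow_three hm h3
  have e0 : charFun (P.map ξ) t = ∫ ω, Complex.exp (((t * ξ ω : ℝ) : ℂ) * Complex.I) ∂P := by
    rw [charFun_apply_real, integral_map hm (by fun_prop)]
    simp
  have j0 := integrable_exp_mul_I (hm.const_mul t)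
  have j1 : Integrable (fun ω => ((t * ξ ω : ℝ) : ℂ) * Complex.I) P :=
    ((i1.const_mul t).ofReal).mul_const _
  have j2 : Integrable (fun ω => ((t * ξ ω : ℝ) : ℂ) ^ 2 / 2) P := by
    have := ((i2.const_mul (t ^ 2)).ofReal (𝕜 := ℂ)).div_const 2
    refine this.congr (Eventually.of_forall fun ω => ?_)
    simp [mul_pow]
  have e1 : ∫ ω, (((t * ξ ω : ℝ) : ℂ) * Complex.I) ∂P = t * (∫ ω, ξ ω ∂P) * Complex.I := by
    rw [integral_mul_const, integral_complex_ofReal, integral_const_mul]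
    push_cast
    rfl
  have e2 : ∫ ω, (((t * ξ ω : ℝ) : ℂ) ^ 2 / 2) ∂P =
      (t : ℂ) ^ 2 * ((∫ ω, ξ ω ^ 2 ∂P : ℝ) : ℂ) / 2 := by
    have : ∀ ω, ((t * ξ ω : ℝ) : ℂ) ^ 2 / 2 = ((t ^ 2 * ξ ω ^ 2 / 2 : ℝ) : ℂ) := by
      intro ω; push_cast; ring
    simp_rw [this]
    rw [integral_complex_ofReal, integral_div, integral_const_mul]
    push_cast
    rfl
  have e3 : charFun (P.map ξ) t - 1 -
      (t * (∫ ω, ξ ω ∂P) * Complex.I - t ^ 2 * (∫ ω, ξ ω ^ 2 ∂P) / 2) =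
      ∫ ω, (Complex.exp (((t * ξ ω : ℝ) : ℂ) * Complex.I) -
        (1 + ((t * ξ ω : ℝ) : ℂ) * Complex.I - ((t * ξ ω : ℝ) : ℂ) ^ 2 / 2)) ∂P := by
    have k1 : Integrable (fun ω => (1 : ℂ) + ((t * ξ ω : ℝ) : ℂ) * Complex.I) P :=
      (integrable_const _).add j1
    rw [integral_sub (g := fun ω => 1 + ((t * ξ ω : ℝ) : ℂ) * Complex.I -
        ((t * ξ ω : ℝ) : ℂ) ^ 2 / 2) j0 (k1.sub j2), integral_sub k1 j2,
      integral_add (integrable_const _) j1, e0, e1, e2]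
    simp
    ring
  rw [e3, ← integral_const_mul]
  refine norm_integral_le_of_norm_le (h3.const_mul _) (Eventually.of_forall fun ω => ?_)
  refine (norm_exp_mul_I_sub_quadratic_le _).trans_eq ?_
  rw [abs_mul, mul_pow]
  ring

lemma norm_charFun_sub_one_le {Ω : Type*} [MeasurableSpace Ω] {P : Measure Ω}
    [IsProbabilityMeasure P] {ξ : Ω → ℝ} (hm : AEMeasurable ξ P)
    (h1 : Integrable ξ P) (t : ℝ) :
    ‖charFun (P.map ξ) t - 1‖ ≤ |t| * ∫ ω, |ξ ω| ∂P := by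
  have e0 : charFun (P.map ξ) t - 1 =
      ∫ ω, (Complex.exp (((t * ξ ω : ℝ) : ℂ) * Complex.I) - 1) ∂P := by
    rw [integral_sub (integrable_exp_mul_I (hm.const_mul t)) (integrable_const _),
      charFun_apply_real, integral_map hm (by fun_prop)]
    simp
  rw [e0, ← integral_const_mul]
  refine norm_integral_le_of_norm_le (h1.abs.const_mul _) (Eventually.of_forall fun ω => ?_)
  rw [mul_comm _ Complex.I]
  refine Real.norm_exp_I_mul_ofReal_sub_one_le.trans_eq ?_
  rw [Real.norm_eq_abs, abs_mul]

/-- **Lyapunov central limit theorem** for triangular arrays which are not necessarily centred. -/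
theorem tendstoInDistribution_sum_of_lyapunov {Ω : Type*} [MeasurableSpace Ω] {P : Measure Ω}
    [IsProbabilityMeasure P] {ξ : ℕ → ℕ → Ω → ℝ} {M V : ℝ} (hV : 0 ≤ V)
    (hm : ∀ n k, AEMeasurable (ξ n k) P) (hindep : ∀ n, iIndepFun (ξ n) P)
    (hint : ∀ n k, Integrable (fun ω => |ξ n k ω| ^ 3) P)
    (h1 : Tendsto (fun n => ∑ k ∈ Finset.range n, ∫ ω, ξ n k ω ∂P) atTop (𝓝 M))
    (h2 : Tendsto (fun n => ∑ k ∈ Finset.range n, ∫ ω, ξ n k ω ^ 2 ∂P) atTop (𝓝 V))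
    (h3 : Tendsto (fun n => ∑ k ∈ Finset.range n, ∫ ω, |ξ n k ω| ^ 3 ∂P) atTop (𝓝 0))
    (h4 : Tendsto (fun n => ∑ k ∈ Finset.range n, (∫ ω, |ξ n k ω| ∂P) ^ 2) atTop (𝓝 0)) :
    TendstoInDistribution (fun n ω => ∑ k ∈ Finset.range n, ξ n k ω) atTop id (fun _ => P)
      (gaussianReal M V.toNNReal) where
  forall_aemeasurable n := Finset.aemeasurable_fun_sum _ fun _ _ => hm n _
  tendsto := by
    refine ProbabilityMeasure.tendsto_iff_tendsto_charFun.2 fun t => ?_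
    -- The limiting exponent uses raw second moments in place of variances; by `h4` the squared
    -- means sum to zero in the limit, so nothing is lost.
    have hz1 : Tendsto (fun n => ∑ k ∈ Finset.range n, (charFun (P.map (ξ n k)) t - 1)) atTop
        (𝓝 (t * M * Complex.I - t ^ 2 * V / 2)) := by
      have hmain : Tendsto (fun n => (t * (∑ k ∈ Finset.range n, ∫ ω, ξ n k ω ∂P : ℝ) * Complex.I
          - t ^ 2 * (∑ k ∈ Finset.range n, ∫ ω, ξ n k ω ^ 2 ∂P : ℝ) / 2 : ℂ)) atTop
          (𝓝 (t * M * Complex.I - t ^ 2 * V / 2)) := by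
        have c1 := (Complex.continuous_ofReal.tendsto M).comp h1
        have c2 := (Complex.continuous_ofReal.tendsto V).comp h2
        exact ((c1.const_mul (t : ℂ)).mul_const Complex.I).sub
          ((c2.const_mul ((t : ℂ) ^ 2)).div_const 2)
      have hrem : Tendsto (fun n => ∑ k ∈ Finset.range n, (charFun (P.map (ξ n k)) t - 1 -
          (t * (∫ ω, ξ n k ω ∂P) * Complex.I - t ^ 2 * (∫ ω, ξ n k ω ^ 2 ∂P) / 2))) atTop
          (𝓝 0) := by
        have := h3.const_mul (4 * |t| ^ 3)
        rw [mul_zero] at this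
        refine squeeze_zero_norm (fun n => ?_) this
        rw [Finset.mul_sum]
        exact (norm_sum_le _ _).trans
          (Finset.sum_le_sum fun k _ => norm_charFun_sub_quadratic_le (hm n k) (hint n k) t)
      have := hrem.add hmain
      rw [zero_add] at this
      refine this.congr fun n => ?_
      push_cast
      rw [Finset.sum_sub_distrib (s := Finset.range n)
          (f := fun k => charFun (P.map (ξ n k)) t - 1),
        Finset.sum_sub_distrib (s := Finset.range n)
          (f := fun k => (t : ℂ) * (∫ ω, ξ n k ω ∂P : ℝ) * Complex.I), Finset.mul_sum, Finset.mul_sum, Finset.sum_mul, Finset.sum_div]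
      ring
    have hz2 : Tendsto (fun n => ∑ k ∈ Finset.range n, ‖charFun (P.map (ξ n k)) t - 1‖ ^ 2) atTop
        (𝓝 0) := by
      have := h4.const_mul (|t| ^ 2)
      rw [mul_zero] at this
      refine squeeze_zero (fun n => Finset.sum_nonneg fun _ _ => by positivity) (fun n => ?_) this
      rw [Finset.mul_sum]
      refine Finset.sum_le_sum fun k _ => ?_
      rw [← mul_pow]
      gcongr
      exact norm_charFun_sub_one_le (hm n k)
        (integrable_of_integrable_abs_pow_three (hm n k) (hint n k)).1 t
    have hprod := tendsto_prod_one_add_exp hz1 hz2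
    have hlim : charFun (gaussianReal M V.toNNReal) t =
        Complex.exp (t * M * Complex.I - t ^ 2 * V / 2) := by
      rw [charFun_gaussianReal, Real.coe_toNNReal _ hV]
      congr 1
      ring
    simp only [ProbabilityMeasure.coe_mk, Measure.map_id, hlim]
    refine hprod.congr fun n => ?_
    rw [((hindep n).restrict _).charFun_map_fun_finsetSum_eq_prod (fun _ _ => hm n _)]
    simp

/-! ### Integrals against the joint law -/

/-- The law with density `g`. -/
abbrev jointLaw (g : ℝ → ℝ → ℝ) : Measure (ℝ × ℝ) :=
  (volume : Measure (ℝ × ℝ)).withDensity (fun p => ENNReal.ofReal (g p.1 p.2))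

section Law

variable {g : ℝ → ℝ → ℝ} {φ L : ℝ → ℝ}

/-- By Fubini, integrating the absolute value in `t` first leaves at most a constant times `|L (η *
(x - s))|`, which is integrable in `s`. -/
lemma integrable_density_mul (hg : Measurable (Function.uncurry g)) (hg0 : ∀ s t, 0 ≤ g s t)
    (hφ : Measurable φ) (hL : Measurable L) (hLi : Integrable L)
    (hi : ∀ s, Integrable (fun t => φ t * g s t)) (hb : Bdd (fun s => ∫ t, |φ t| * g s t)) {η : ℝ}
    (hη : 0 < η) (x : ℝ) :
    Integrable (fun p : ℝ × ℝ => g p.1 p.2 * (φ p.2 * L (η * (x - p.1)))) := by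
  obtain ⟨C, hC⟩ := hb
  have hgm : Measurable (fun p : ℝ × ℝ => g p.1 p.2) := hg
  have hm : Measurable (fun p : ℝ × ℝ => g p.1 p.2 * (φ p.2 * L (η * (x - p.1)))) := by
    fun_prop
  rw [Measure.volume_eq_prod, integrable_prod_iff hm.aestronglyMeasurable]
  constructor
  · refine Eventually.of_forall fun s => ?_
    refine ((hi s).mul_const (L (η * (x - s)))).congr (Eventually.of_forall fun t => ?_)
    simp only
    ring
  · have hLs : Integrable (fun s => L (η * (x - s))) :=
      (hLi.comp_mul_left' hη.ne').comp_sub_left x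
    refine (hLs.abs.const_mul C).mono'
      (hm.aestronglyMeasurable (μ := (volume : Measure ℝ).prod volume)).norm.integral_prod_right'
      (Eventually.of_forall fun s => ?_)
    have e : ∫ t, ‖g s t * (φ t * L (η * (x - s)))‖ = (∫ t, |φ t| * g s t) * |L (η * (x - s))| := by
      rw [← integral_mul_const]
      refine integral_congr_ae (Eventually.of_forall fun t => ?_)
      simp only [Real.norm_eq_abs, abs_mul, abs_of_nonneg (hg0 s t)]
      ring
    simp only [e]
    rw [Real.norm_eq_abs, abs_mul, abs_abs]
    gcongr
    exact hC s

lemma integrable_jointLaw (hg : Measurable (Function.uncurry g)) (hg0 : ∀ s t, 0 ≤ g s t)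
    (hφ : Measurable φ) (hL : Measurable L) (hLi : Integrable L)
    (hi : ∀ s, Integrable (fun t => φ t * g s t)) (hb : Bdd (fun s => ∫ t, |φ t| * g s t)) {η : ℝ}
    (hη : 0 < η) (x : ℝ) :
    Integrable (fun p : ℝ × ℝ => φ p.2 * L (η * (x - p.1))) (jointLaw g) := by
  have hgm : Measurable (fun p : ℝ × ℝ => g p.1 p.2) := hg
  refine (integrable_withDensity_iff_integrable_smul hgm.real_toNNReal).2 ?_
  refine (integrable_density_mul hg hg0 hφ hL hLi hi hb hη x).congr
    (Eventually.of_forall fun p => ?_)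
  simp [NNReal.smul_def, Real.coe_toNNReal _ (hg0 _ _)]

/-- Fubini and the substitution `z = η (x - s)`; the Jacobian is the factor `η⁻¹`. -/
lemma integral_jointLaw (hg : Measurable (Function.uncurry g)) (hg0 : ∀ s t, 0 ≤ g s t)
    (hφ : Measurable φ) (hL : Measurable L) (hLi : Integrable L)
    (hi : ∀ s, Integrable (fun t => φ t * g s t)) (hb : Bdd (fun s => ∫ t, |φ t| * g s t)) {η : ℝ}
    (hη : 0 < η) (x : ℝ) :
    ∫ p : ℝ × ℝ, φ p.2 * L (η * (x - p.1)) ∂(jointLaw g) =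
      η⁻¹ * ∫ z, L z * ∫ t, φ t * g (x - η⁻¹ * z) t := by
  have hgm : Measurable (fun p : ℝ × ℝ => g p.1 p.2) := hg
  have e1 : ∫ p : ℝ × ℝ, φ p.2 * L (η * (x - p.1)) ∂(jointLaw g) =
      ∫ p : ℝ × ℝ, g p.1 p.2 * (φ p.2 * L (η * (x - p.1))) := by
    refine (integral_withDensity_eq_integral_smul hgm.real_toNNReal _).trans ?_
    refine integral_congr_ae (Eventually.of_forall fun p => ?_)
    simp [NNReal.smul_def, Real.coe_toNNReal _ (hg0 _ _)]
  have hint := integrable_density_mul hg hg0 hφ hL hLi hi hb hη x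
  rw [Measure.volume_eq_prod] at hint
  rw [e1, Measure.volume_eq_prod, integral_prod _ hint]
  have e2 : ∀ s, ∫ t, g s t * (φ t * L (η * (x - s))) =
      (fun z => L z * ∫ t, φ t * g (x - η⁻¹ * z) t) (η * (x - s)) := by
    intro s
    simp only
    rw [← mul_assoc η⁻¹, inv_mul_cancel₀ hη.ne', one_mul, sub_sub_cancel, ← integral_const_mul]
    refine integral_congr_ae (Eventually.of_forall fun t => ?_)
    simp only
    ring
  simp_rw [e2]
  rw [integral_sub_left_eq_self (fun s => (fun z => L z * ∫ t, φ t * g (x - η⁻¹ * z) t) (η * s)),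
    Measure.integral_comp_mul_left (fun z => L z * ∫ t, φ t * g (x - η⁻¹ * z) t), abs_of_pos (inv_pos.2 hη), smul_eq_mul]

end Law

/-! ### Kernel smoothing and its bias -/

/-- The smoothing `∫ L(z) m(x - h z) dz` of a function `m` at scale `h`. -/
def smooth (L m : ℝ → ℝ) (x h : ℝ) : ℝ := ∫ z, L z * m (x - h * z)

lemma abs_smooth_le {L m : ℝ → ℝ} {C : ℝ} (hL : Integrable L) (hC : ∀ s, |m s| ≤ C) (x h : ℝ) :
    |smooth L m x h| ≤ C * ∫ z, |L z| := by
  rw [← integral_const_mul, smooth, ← Real.norm_eq_abs]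
  refine norm_integral_le_of_norm_le (hL.abs.const_mul C) (Eventually.of_forall fun z => ?_)
  rw [Real.norm_eq_abs, abs_mul, mul_comm]
  gcongr
  exact hC _

lemma tendsto_smooth {L m : ℝ → ℝ} {x : ℝ} {h : ℕ → ℝ} (hL : Integrable L) (hm : Measurable m)
    (hb : Bdd m) (hc : ContinuousAt m x) (hh : Tendsto h atTop (𝓝 0)) :
    Tendsto (fun n => smooth L m x (h n)) atTop (𝓝 (m x * ∫ z, L z)) := by
  obtain ⟨C, hC⟩ := hb
  rw [← integral_const_mul]
  refine tendsto_integral_of_dominated_convergence (fun z => C * |L z|) (fun n => ?_)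
    (hL.abs.const_mul C) (fun n => Eventually.of_forall fun z => ?_)
    (Eventually.of_forall fun z => ?_)
  · exact hL.aestronglyMeasurable.mul
      (hm.comp (by fun_prop : Measurable fun z => x - h n * z)).aestronglyMeasurable
  · rw [Real.norm_eq_abs, abs_mul, mul_comm]
    gcongr
    exact hC _
  · have : Tendsto (fun n => x - h n * z) atTop (𝓝 x) := by
      simpa using (hh.mul_const z).const_sub x
    have h2 := (hc.tendsto.comp this).const_mul (L z)
    rwa [mul_comm (L z) (m x)] at h2

/-- The remainder of the second order Taylor expansion of `m` at `x`. -/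
def taylorRem (m : ℝ → ℝ) (x u : ℝ) : ℝ :=
  m (x + u) - m x - deriv m x * u - deriv (deriv m) x / 2 * u ^ 2

/-- Taylor's formula in Peano form: the derivative of the remainder is `o(v)` because `deriv m` is
differentiable at `x`, and the mean value inequality on the ball of radius `|u|` gains the second
factor `|u|`. -/
lemma TwiceDiffAt.abs_taylorRem_le {m : ℝ → ℝ} {x : ℝ} (hm : TwiceDiffAt m x) {ε : ℝ}
    (hε : 0 < ε) : ∃ δ > 0, ∀ u, |u| < δ → |taylorRem m x u| ≤ ε * u ^ 2 := by
  obtain ⟨h1, h2⟩ := hm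
  have h3 := (hasDerivAt_iff_isLittleO.1 h2.hasDerivAt).def hε
  obtain ⟨δ, hδ, hball⟩ := Metric.eventually_nhds_iff.1 (h1.and h3)
  refine ⟨δ, hδ, fun u hu => ?_⟩
  have hd : ∀ v : ℝ, |v| < δ → HasDerivAt (taylorRem m x)
      (deriv m (x + v) - deriv m x - deriv (deriv m) x * v) v := by
    intro v hv
    have a1 := (hball (y := x + v) (by simpa [Real.dist_eq] using hv)).1.hasDerivAt
    have a2 : HasDerivAt (fun u => m (x + u)) (deriv m (x + v)) v := by
      simpa using HasDerivAt.comp_const_add x v a1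
    have a3 := (((a2.sub_const (m x)).sub ((hasDerivAt_id v).const_mul (deriv m x))).sub
      (((hasDerivAt_id v).pow 2).const_mul (deriv (deriv m) x / 2)))
    refine HasDerivAt.congr_deriv a3 ?_
    simp
    ring
  have hbound : ∀ v ∈ Metric.closedBall (0 : ℝ) |u|,
      ‖deriv m (x + v) - deriv m x - deriv (deriv m) x * v‖ ≤ ε * |u| := by
    intro v hv
    have hv' : |v| ≤ |u| := by simpa using hv
    have := (hball (y := x + v) (by simpa [Real.dist_eq] using hv'.trans_lt hu)).2
    simp only [add_sub_cancel_left, smul_eq_mul, Real.norm_eq_abs] at this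
    rw [Real.norm_eq_abs, mul_comm (deriv (deriv m) x)]
    exact this.trans (by gcongr)
  have := (convex_closedBall (0 : ℝ) |u|).norm_image_sub_le_of_norm_hasDerivWithin_le
    (f := taylorRem m x)
    (fun v hv => (hd v ((show |v| ≤ |u| by simpa using hv).trans_lt hu)).hasDerivWithinAt) hbound
    (show (0 : ℝ) ∈ Metric.closedBall (0 : ℝ) |u| by simp)
    (show u ∈ Metric.closedBall (0 : ℝ) |u| by simp)
  have h0 : taylorRem m x 0 = 0 := by simp [taylorRem]
  rw [h0, sub_zero, sub_zero, Real.norm_eq_abs, Real.norm_eq_abs, mul_assoc, ← sq, sq_abs] at this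
  exact this

/-- A global bound supplies the dominating function for the bias. Near `0` it is the Peano estimate;
for `|u| ≥ δ` each constant or linear term is absorbed by `u ^ 2` at the cost of powers of `δ⁻¹`. -/
lemma TwiceDiffAt.exists_taylorRem_bound {m : ℝ → ℝ} {x : ℝ} (hm : TwiceDiffAt m x)
    (hb : Bdd m) : ∃ C, ∀ u, |taylorRem m x u| ≤ C * u ^ 2 := by
  obtain ⟨C, hC⟩ := hb
  obtain ⟨δ, hδ, h⟩ := hm.abs_taylorRem_le one_pos
  have hC0 : 0 ≤ C := (abs_nonneg _).trans (hC 0)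
  set D := 2 * C / δ ^ 2 + |deriv m x| / δ + |deriv (deriv m) x / 2|
  have hD : 0 ≤ D := by positivity
  refine ⟨1 + D, fun u => ?_⟩
  rcases lt_or_ge |u| δ with hu | hu
  · exact (h u hu).trans (by gcongr; linarith)
  · have hu2 : u ^ 2 = |u| ^ 2 := (sq_abs u).symm
    have t1 : |m (x + u)| + |m x| ≤ 2 * C / δ ^ 2 * u ^ 2 := by
      have : 2 * C ≤ 2 * C / δ ^ 2 * u ^ 2 := by
        rw [hu2, div_mul_eq_mul_div, le_div_iff₀ (by positivity)]
        gcongr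
      linarith [hC (x + u), hC x]
    have t2 : |deriv m x * u| ≤ |deriv m x| / δ * u ^ 2 := by
      rw [abs_mul, hu2, div_mul_eq_mul_div, le_div_iff₀ hδ, mul_assoc]
      gcongr
      rw [sq]
      gcongr
    have t3 : |deriv (deriv m) x / 2 * u ^ 2| = |deriv (deriv m) x / 2| * u ^ 2 := by
      rw [abs_mul, abs_of_nonneg (sq_nonneg u)]
    have t4 : |taylorRem m x u| ≤ |m (x + u)| + |m x| + |deriv m x * u| +
        |deriv (deriv m) x / 2 * u ^ 2| := by
      refine (abs_sub _ _).trans (add_le_add ((abs_sub _ _).trans (add_le_add ?_ le_rfl)) le_rfl)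
      exact abs_sub _ _
    nlinarith [sq_nonneg u]

/-- The bias of kernel smoothing. -/
lemma tendsto_smooth_bias {K m : ℝ → ℝ} {x : ℝ} {h : ℕ → ℝ} (hK : KernelAssumption K)
    (hm : Measurable m) (hb : Bdd m) (h2 : TwiceDiffAt m x) (hpos : ∀ n, 0 < h n)
    (hh : Tendsto h atTop (𝓝 0)) :
    Tendsto (fun n => (smooth K m x (h n) - m x) / h n ^ 2) atTop
      (𝓝 (iteratedDeriv 2 m x / 2 * kerMu 2 K)) := by
  obtain ⟨C, hC⟩ := h2.exists_taylorRem_bound hb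
  have hKm : AEStronglyMeasurable K volume := hK.cont.aestronglyMeasurable
  have hrm : Measurable (taylorRem m x) := by unfold taylorRem; fun_prop
  have i1 : Integrable (fun z => z * K z) := by
    refine (hK.integrable.abs.add hK.integrable_sq.abs).mono' (by
      exact (continuous_id.mul hK.cont).aestronglyMeasurable) (Eventually.of_forall fun z => ?_)
    simp only [Real.norm_eq_abs, abs_mul, Pi.add_apply, abs_pow]
    have : |z| ≤ 1 + |z| ^ 2 := by nlinarith [sq_nonneg (|z| - 1), abs_nonneg z]
    nlinarith [abs_nonneg (K z)]
  have ir : ∀ n, Integrable (fun z => K z * taylorRem m x (-(h n * z))) := by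
    intro n
    refine (hK.integrable_sq.abs.const_mul (C * h n ^ 2)).mono' (hKm.mul
      (hrm.comp (by fun_prop : Measurable fun z => -(h n * z))).aestronglyMeasurable)
      (Eventually.of_forall fun z => ?_)
    rw [Real.norm_eq_abs, abs_mul, abs_mul, abs_of_nonneg (sq_nonneg z)]
    have := hC (-(h n * z))
    calc |K z| * |taylorRem m x (-(h n * z))| ≤ |K z| * (C * (-(h n * z)) ^ 2) := by gcongr
      _ = _ := by ring
  -- The conditions `∫ K = 1` and `∫ z K = 0` remove the orders zero and one.
  have hexp : ∀ n, (smooth K m x (h n) - m x) / h n ^ 2 =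
      iteratedDeriv 2 m x / 2 * kerMu 2 K +
        ∫ z, (K z * taylorRem m x (-(h n * z))) / h n ^ 2 := by
    intro n
    have e : ∀ z, K z * m (x - h n * z) = m x * K z - (deriv m x * h n) * (z * K z) +
        (deriv (deriv m) x / 2 * h n ^ 2) * (z ^ 2 * K z) + K z * taylorRem m x (-(h n * z)) := by
      intro z
      simp only [taylorRem, ← sub_eq_add_neg]
      ring
    have e2 : smooth K m x (h n) = m x + deriv (deriv m) x / 2 * h n ^ 2 * kerMu 2 K +
        ∫ z, K z * taylorRem m x (-(h n * z)) := by
      rw [smooth]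
      simp_rw [e]
      have j1 : Integrable (fun z => m x * K z - (deriv m x * h n) * (z * K z)) :=
        (hK.integrable.const_mul _).sub (i1.const_mul _)
      have j2 : Integrable (fun z => m x * K z - (deriv m x * h n) * (z * K z) +
          (deriv (deriv m) x / 2 * h n ^ 2) * (z ^ 2 * K z)) :=
        j1.add (hK.integrable_sq.const_mul _)
      rw [integral_add j2 (ir n), integral_add j1 (hK.integrable_sq.const_mul _),
        integral_sub (hK.integrable.const_mul _) (i1.const_mul _), integral_const_mul, integral_const_mul, integral_const_mul,
        hK.integral_eq_one, hK.integral_mul_eq_zero, kerMu]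
      ring
    have hn := (hpos n).ne'
    rw [integral_div, e2, iteratedDeriv_succ, iteratedDeriv_one]
    field_simp
    ring
  simp_rw [hexp]
  have hlim : Tendsto (fun n => ∫ z, (K z * taylorRem m x (-(h n * z))) / h n ^ 2) atTop
      (𝓝 (∫ z : ℝ, (0 : ℝ))) := by
    refine tendsto_integral_of_dominated_convergence (fun z => C * |z ^ 2 * K z|)
      (fun n => ((ir n).div_const _).aestronglyMeasurable) (hK.integrable_sq.abs.const_mul C)
      (fun n => Eventually.of_forall fun z => ?_) (Eventually.of_forall fun z => ?_)
    · have hn := pow_pos (hpos n) 2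
      rw [Real.norm_eq_abs, abs_div, abs_of_pos hn, div_le_iff₀ hn, abs_mul, abs_mul,
        abs_of_nonneg (sq_nonneg z)]
      calc |K z| * |taylorRem m x (-(h n * z))| ≤ |K z| * (C * (-(h n * z)) ^ 2) := by
            gcongr; exact hC _
        _ = _ := by ring
    · rw [Metric.tendsto_atTop']
      intro ε hε
      -- The pointwise limit is for fixed `z`, so the tolerance may depend on `z`; the `+ 1` avoids
      -- dividing by zero.
      obtain ⟨δ, hδ, hs⟩ := h2.abs_taylorRem_le
        (show 0 < ε / (z ^ 2 * |K z| + 1) by positivity)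
      have ht : Tendsto (fun n => |-(h n * z)|) atTop (𝓝 0) := by
        simpa using ((hh.mul_const z).neg).abs
      obtain ⟨N, hN⟩ := eventually_atTop.1 (ht.eventually (gt_mem_nhds hδ))
      refine ⟨N, fun n hnN => ?_⟩
      have hn := pow_pos (hpos n) 2
      have hr := hs _ (hN n hnN.le)
      rw [Real.dist_eq, sub_zero, abs_div, abs_of_pos hn, div_lt_iff₀ hn, abs_mul]
      calc |K z| * |taylorRem m x (-(h n * z))|
          ≤ |K z| * (ε / (z ^ 2 * |K z| + 1) * (-(h n * z)) ^ 2) := by gcongr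
        _ = (ε * (z ^ 2 * |K z|) / (z ^ 2 * |K z| + 1)) * h n ^ 2 := by ring
        _ < ε * h n ^ 2 := by
          gcongr
          rw [div_lt_iff₀ (by positivity)]
          nlinarith
  simpa using hlim.const_add (iteratedDeriv 2 m x / 2 * kerMu 2 K)

/-! ### Weak law and Slutsky's theorem -/

section Probability

variable {Ω : Type*} [MeasurableSpace Ω] {P : Measure Ω} [IsProbabilityMeasure P]

/-- Weak law of large numbers for triangular arrays. -/
lemma tendstoInMeasure_sum {ξ : ℕ → ℕ → Ω → ℝ} {M : ℝ}
    (hm : ∀ n k, AEMeasurable (ξ n k) P) (hindep : ∀ n, iIndepFun (ξ n) P)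
    (hint : ∀ n k, Integrable (fun ω => ξ n k ω ^ 2) P)
    (h1 : Tendsto (fun n => ∑ k ∈ Finset.range n, ∫ ω, ξ n k ω ∂P) atTop (𝓝 M))
    (h2 : Tendsto (fun n => ∑ k ∈ Finset.range n, ∫ ω, ξ n k ω ^ 2 ∂P) atTop (𝓝 0)) :
    TendstoInMeasure P (fun n ω => ∑ k ∈ Finset.range n, ξ n k ω) atTop (fun _ => M) := by
  have hL : ∀ n k, MemLp (ξ n k) 2 P := fun n k =>
    (memLp_two_iff_integrable_sq (hm n k).aestronglyMeasurable).2 (hint n k)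
  have hS : ∀ n, MemLp (∑ k ∈ Finset.range n, ξ n k) 2 P := fun n =>
    memLp_finsetSum' _ fun k _ => hL n k
  have hvar : ∀ n, variance (∑ k ∈ Finset.range n, ξ n k) P ≤
      ∑ k ∈ Finset.range n, ∫ ω, ξ n k ω ^ 2 ∂P := by
    intro n
    rw [IndepFun.variance_sum (fun k _ => hL n k)
      (fun i _ j _ hij => (hindep n).indepFun hij)]
    exact Finset.sum_le_sum fun k _ => variance_le_expectation_sq (hm n k).aestronglyMeasurable
  have hmean : ∀ n, ∫ ω, (∑ k ∈ Finset.range n, ξ n k) ω ∂P =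
      ∑ k ∈ Finset.range n, ∫ ω, ξ n k ω ∂P := by
    intro n
    simp_rw [Finset.sum_apply]
    exact integral_finsetSum _ fun k _ => (hL n k).integrable one_le_two
  rw [tendstoInMeasure_iff_norm]
  intro ε hε
  have hlim : Tendsto (fun n => ENNReal.ofReal
      ((∑ k ∈ Finset.range n, ∫ ω, ξ n k ω ^ 2 ∂P) / (ε / 2) ^ 2)) atTop (𝓝 0) := by
    have := ENNReal.tendsto_ofReal (h2.div_const ((ε / 2) ^ 2))
    simpa using this
  refine tendsto_of_tendsto_of_tendsto_of_le_of_le' tendsto_const_nhds hlim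
    (Eventually.of_forall fun n => zero_le) ?_
  -- Half of `ε` pays for the distance from the mean to `M`, half for Chebyshev's inequality.
  filter_upwards [Metric.tendsto_nhds.1 h1 (ε / 2) (half_pos hε)] with n hn
  rw [Real.dist_eq, ← hmean n] at hn
  refine (measure_mono fun ω hω => ?_).trans
    ((meas_ge_le_variance_div_sq (hS n) (half_pos hε)).trans
      (ENNReal.ofReal_le_ofReal (by gcongr; exact hvar n)))
  simp only [Set.mem_ofPred_eq, Real.norm_eq_abs] at hω ⊢
  have := abs_sub_le (∑ k ∈ Finset.range n, ξ n k ω) (∫ ω, (∑ k ∈ Finset.range n, ξ n k) ω ∂P) M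
  rw [Finset.sum_apply]
  linarith

/-- Slutsky's theorem for quotients with a Gaussian limit. -/
lemma tendstoInDistribution_div {T F Z : ℕ → Ω → ℝ} {M V f : ℝ} (hf : 0 < f) (hV : 0 ≤ V)
    (hT : TendstoInDistribution T atTop id (fun _ => P) (gaussianReal M V.toNNReal))
    (hF : TendstoInMeasure P F atTop (fun _ => f)) (hFm : ∀ n, AEMeasurable (F n) P)
    (hZm : ∀ n, AEMeasurable (Z n) P)
    (hZ : ∀ n ω, f / 2 < F n ω → Z n ω = T n ω / F n ω) :
    TendstoInDistribution Z atTop id (fun _ => P) (gaussianReal (M / f) (V / f ^ 2).toNNReal) := by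
  -- Truncating the denominator at `f / 2` makes the quotient continuous everywhere; it differs from
  -- the true quotient only on an event of vanishing probability.
  have hG : Continuous fun p : ℝ × ℝ => p.1 / max p.2 (f / 2) :=
    continuous_fst.div (continuous_snd.max continuous_const)
      fun p => ((half_pos hf).trans_le (le_max_right _ _)).ne'
  have h1 := hT.continuous_comp_prodMk_of_tendstoInMeasure_const hG hF hFm
  simp only [max_eq_left (half_le_self hf.le), id] at h1
  have h2 : TendstoInDistribution Z atTop (fun y => y / f) (fun _ => P)
      (gaussianReal M V.toNNReal) := by
    refine tendstoInDistribution_of_tendstoInMeasure_sub Z _ h1 ?_ hZm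
    rw [tendstoInMeasure_iff_norm] at hF ⊢
    intro ε hε
    refine tendsto_of_tendsto_of_tendsto_of_le_of_le tendsto_const_nhds (hF (f / 2) (half_pos hf))
      (fun n => zero_le) (fun n => measure_mono fun ω hω => ?_)
    simp only [Set.mem_ofPred_eq, Pi.sub_apply, Pi.zero_apply, sub_zero, Real.norm_eq_abs] at hω ⊢
    by_contra! hcon
    have h3 : f / 2 < F n ω := by linarith [(abs_lt.1 hcon).1]
    rw [hZ n ω h3, max_eq_left h3.le, sub_self, abs_zero] at hω
    linarith
  have hmap : (gaussianReal M V.toNNReal).map (fun y => y / f) =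
      gaussianReal (M / f) (V / f ^ 2).toNNReal := by
    rw [gaussianReal_map_div_const]
    congr 1
    apply NNReal.eq
    rw [NNReal.coe_div, Real.coe_toNNReal _ hV, Real.coe_toNNReal _ (by positivity)]
    rfl
  refine ⟨hZm, aemeasurable_id, ?_⟩
  have h4 := h2.tendsto
  convert h4 using 2
  exact congrArg 𝓝 (Subtype.ext (Measure.map_id.trans hmap.symm))

end Probability

/-! ### Weighted sums involving the bandwidth -/

/-- Bandwidths of order `n ^ (-a)`, with `n h_n ^ 5 → c`. -/
structure Bandwidth (h : ℕ → ℝ) (a c : ℝ) : Prop where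
  mem : a ∈ Set.Ioo (0 : ℝ) 1
  gs : GS (-a) h
  nonneg : 0 ≤ c
  lim : Tendsto (fun n : ℕ => (n : ℝ) * h n ^ 5) atTop (𝓝 c)

namespace Bandwidth

variable {h : ℕ → ℝ} {a c b b' : ℝ} (hB : Bandwidth h a c)
include hB

lemma pos (n : ℕ) : 0 < h (n + 1) := hB.gs.pos _ (by omega)

lemma isDecay : IsDecay (fun n _ => h n) a := by
  simpa using hB.gs.isDecay

lemma tendsto_zero : Tendsto h atTop (𝓝 0) := hB.isDecay.tendsto_zero hB.mem.1

lemma tendsto_zero_succ : Tendsto (fun n => h (n + 1)) atTop (𝓝 0) :=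
  (tendsto_add_atTop_iff_nat 1).2 hB.tendsto_zero

lemma isDecay_mul : IsDecay (fun n _ => (n : ℝ) * h n) (-(1 - a)) := by
  have := isDecay_natCast.mul hB.isDecay
  rwa [show -1 + a = -(1 - a) by ring] at this

lemma isDecay_sqrt : IsDecay (fun n _ => √((n : ℝ) * h n)) (-(1 - a) / 2) := hB.isDecay_mul.sqrt

lemma tendsto_inv : Tendsto (fun n : ℕ => ((n : ℝ) * h n)⁻¹) atTop (𝓝 0) :=
  hB.isDecay_mul.inv.tendsto_zero (by linarith [hB.mem.2])

lemma tendsto_inv_succ : Tendsto (fun n : ℕ => (((n : ℝ) + 1) * h (n + 1))⁻¹) atTop (𝓝 0) := by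
  have := (tendsto_add_atTop_iff_nat 1).2 hB.tendsto_inv
  simpa using this

/-- The weight has exponent `b + b' - (1 - a)`, and its diagonal term times `n + 1` is exactly `b b'
e_n`. This is the source of the variance constants. -/
lemma tendsto_sum_second {e : ℕ → ℝ} {E : ℝ} (he : Tendsto e atTop (𝓝 E))
    (hb : 1 - a < b + b') :
    Tendsto (fun n : ℕ => ∑ k ∈ Finset.range n,
      ((n : ℝ) * h n * (wt b n k * wt b' n k)) * ((h (k + 1))⁻¹ * e k)) atTop
      (𝓝 (b * b' * E / (b + b' - (1 - a)))) := by
  have hd := hB.isDecay_mul.mul ((isDecay_wt b).mul (isDecay_wt b'))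
  rw [show -(1 - a) + (b + b') = b + b' - (1 - a) by ring] at hd
  refine hd.tendsto_sum (by linarith) ((he.const_mul (b * b')).congr fun n => ?_)
  have h1 := (hB.pos n).ne'
  have h2 : (n : ℝ) + 1 ≠ 0 := by positivity
  rw [wt_self, wt_self]
  push_cast
  field_simp

lemma tendsto_sum_sq (hb : 1 - a < 2 * b) :
    Tendsto (fun n : ℕ => ∑ k ∈ Finset.range n, (n : ℝ) * h n * wt b n k ^ 2) atTop (𝓝 0) := by
  have := hB.tendsto_sum_second hB.tendsto_zero_succ (b := b) (b' := b) (by linarith)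
  simp only [mul_zero, zero_div] at this
  refine this.congr fun n => Finset.sum_congr rfl fun k _ => ?_
  rw [inv_mul_cancel₀ (hB.pos k).ne']
  ring

/-- The exponent is `3 (b - (1 - a) / 2) > 0`, while `n + 1` times the diagonal term is of order `(n
h_n) ^ (-1 / 2)`. -/
lemma tendsto_sum_third (hb : 1 - a < 2 * b) :
    Tendsto (fun n : ℕ => ∑ k ∈ Finset.range n,
      (√((n : ℝ) * h n) ^ 3 * wt b n k ^ 3) * (h (k + 1))⁻¹ ^ 2) atTop (𝓝 0) := by
  have hd := (hB.isDecay_sqrt.pow 3).mul ((isDecay_wt b).pow 3)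
  have hlim : Tendsto (fun n : ℕ => b ^ 3 * √((((n : ℝ) + 1) * h (n + 1))⁻¹)) atTop (𝓝 0) := by
    have := ((Real.continuous_sqrt.tendsto 0).comp hB.tendsto_inv_succ).const_mul (b ^ 3)
    rw [Real.sqrt_zero, mul_zero] at this
    exact this
  have := hd.tendsto_sum (e := fun k => (h (k + 1))⁻¹ ^ 2) (β := 0)
    (by push_cast; linarith) (hlim.congr fun n => ?_)
  · rwa [zero_div] at this
  · have h1 := hB.pos n
    have h2 : (0 : ℝ) < (n : ℝ) + 1 := by positivity
    rw [wt_self, Real.sqrt_inv]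
    push_cast
    have h3 : 0 < ((n : ℝ) + 1) * h (n + 1) := by positivity
    set s := √(((n : ℝ) + 1) * h (n + 1)) with hs
    have hs0 : 0 < s := Real.sqrt_pos.2 h3
    have hs2 : s ^ 2 = ((n : ℝ) + 1) * h (n + 1) := Real.sq_sqrt h3.le
    field_simp
    rw [show s ^ 4 = (s ^ 2) ^ 2 by ring, hs2]
    ring

/-- On the diagonal, `√(n h_n) h_n ^ 2 = √(n h_n ^ 5) → √c`. -/
lemma tendsto_sum_bias {e : ℕ → ℝ} {E : ℝ} (he : Tendsto e atTop (𝓝 E)) (hb : 1 - a < 2 * b) :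
    Tendsto (fun n : ℕ => ∑ k ∈ Finset.range n,
      (√((n : ℝ) * h n) * wt b n k) * (h (k + 1) ^ 2 * e k)) atTop
      (𝓝 (√c * (b * E / (b - (1 - a) / 2)))) := by
  have hd := hB.isDecay_sqrt.mul (isDecay_wt b)
  have hc : Tendsto (fun n : ℕ => √(((n : ℝ) + 1) * h (n + 1) ^ 5)) atTop (𝓝 √c) := by
    have := (tendsto_add_atTop_iff_nat 1).2 hB.lim
    push_cast at this
    exact (Real.continuous_sqrt.tendsto c).comp this
  have := hd.tendsto_sum (e := fun k => h (k + 1) ^ 2 * e k) (β := √c * (b * E))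
    (by linarith) ((hc.mul (he.const_mul b)).congr fun n => ?_)
  · rwa [show -(1 - a) / 2 + b = b - (1 - a) / 2 by ring, mul_div_assoc] at this
  · have h1 := hB.pos n
    have h2 : (0 : ℝ) < (n : ℝ) + 1 := by positivity
    rw [wt_self, show ((n : ℝ) + 1) * h (n + 1) ^ 5 =
      (((n : ℝ) + 1) * h (n + 1)) * (h (n + 1) ^ 2) ^ 2 by ring, Real.sqrt_mul (by positivity),
      Real.sqrt_sq (by positivity)]
    push_cast
    field_simp

/-- The missing mass decays with exponent `b`, which beats the growth exponent `(1 - a) / 2` of `√(n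
h_n)`. -/
lemma tendsto_sqrt_mul_one_sub_sum (hb : 1 - a < 2 * b) :
    Tendsto (fun n : ℕ => √((n : ℝ) * h n) * (1 - ∑ k ∈ Finset.range n, wt b n k)) atTop
      (𝓝 0) := by
  simp_rw [sum_wt_eq, sub_sub_cancel]
  exact (hB.isDecay_sqrt.mul (isDecay_prod b)).tendsto_zero (by linarith)

lemma tendsto_sum_wt_one_sq {e : ℕ → ℝ} {E : ℝ} (he : Tendsto e atTop (𝓝 E)) :
    Tendsto (fun n : ℕ => ∑ k ∈ Finset.range n, wt 1 n k ^ 2 * ((h (k + 1))⁻¹ * e k)) atTop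
      (𝓝 0) := by
  have := hB.tendsto_inv_succ.mul he
  rw [zero_mul] at this
  have := ((isDecay_wt 1).pow 2).tendsto_sum (e := fun k => (h (k + 1))⁻¹ * e k) (by norm_num)
    (this.congr fun n => ?_)
  · rwa [zero_div] at this
  · have h1 := (hB.pos n).ne'
    have h2 : (n : ℝ) + 1 ≠ 0 := by positivity
    rw [wt_self]
    field_simp

/-- If the limit of `n h_n ^ 5` is positive then the bandwidth has order `n ^ (-1 / 5)`. -/
lemma eq_one_fifth (hc : c ≠ 0) : a = 1 / 5 := by
  have hd := isDecay_natCast.mul (hB.isDecay.pow 5)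
  obtain ⟨ρ, h1, h2⟩ := hd
  have hlim := hB.lim
  -- the sequence is also `1 / n`-affine with `A = 1`, which determines its limit
  have := tendsto_of_affine_recursion (S := fun n : ℕ => (n : ℝ) * h n ^ 5)
    (ρ := fun n => 1 - 1 / ((n : ℝ) + 1)) (A := 1) one_pos
    (B := fun n => (1 / ((n : ℝ) + 1) - (1 - ρ n)) * ((n : ℝ) * h n ^ 5))
    (β := (1 - (-1 + 5 * a)) * c) ?_ ?_ ?_
  · have h3 := tendsto_nhds_unique hlim this
    have h4 : (1 - 5 * a) * c = 0 := by linarith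
    rcases mul_eq_zero.1 h4 with h | h
    · linarith
    · exact absurd h hc
  · filter_upwards [h1, eventually_gt_atTop 0] with n hn h0
    rw [hn.2 0 h0]
    ring
  · refine tendsto_const_nhds.congr fun n => ?_
    have : (n : ℝ) + 1 ≠ 0 := by positivity
    field_simp
    ring
  · push_cast at h2
    refine ((h2.const_sub 1).mul hlim).congr fun n => ?_
    have : (n : ℝ) + 1 ≠ 0 := by positivity
    field_simp

end Bandwidth

/-! ### Sampling model and moments of a single term -/

/-- The pairs `(X_n, Y_n)`, `n ≥ 1`, are independent with common density `g`. -/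
structure Sampling {Ω : Type*} [MeasurableSpace Ω] (P : Measure Ω) (X Y : ℕ → Ω → ℝ)
    (g : ℝ → ℝ → ℝ) : Prop where
  meas : Measurable (Function.uncurry g)
  nonneg : ∀ s t, 0 ≤ g s t
  indep : iIndepFun (fun (k : ℕ) (ω : Ω) => (X (k + 1) ω, Y (k + 1) ω)) P
  law : ∀ k : ℕ, HasLaw (fun ω => (X (k + 1) ω, Y (k + 1) ω)) (jointLaw g) P

/-- The `φ`-moments of the density `g` exist and are uniformly bounded. -/
structure MomentFun (g : ℝ → ℝ → ℝ) (φ : ℝ → ℝ) : Prop where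
  meas : Measurable φ
  integrable : ∀ s, Integrable (fun t => φ t * g s t)
  bdd : Bdd (fun s => ∫ t, |φ t| * g s t)

lemma MomentFun.abs {g : ℝ → ℝ → ℝ} {φ : ℝ → ℝ} (hg0 : ∀ s t, 0 ≤ g s t) (h : MomentFun g φ) :
    MomentFun g (fun t => |φ t|) where
  meas := h.meas.abs
  integrable s := (h.integrable s).abs.congr (Eventually.of_forall fun t => by
    simp only [abs_mul, abs_of_nonneg (hg0 s t)])
  bdd := by simpa only [abs_abs] using h.bdd

lemma measurable_moment {g : ℝ → ℝ → ℝ} (hg : Measurable (Function.uncurry g)) (q : ℕ) :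
    Measurable (moment g q) := by
  have : StronglyMeasurable (Function.uncurry fun s t => t ^ q * g s t) :=
    ((measurable_snd.pow_const q).mul hg).stronglyMeasurable
  exact this.integral_prod_right.measurable

section Density

variable {g : ℝ → ℝ → ℝ} {x : ℝ}

/-- Only signed moments are assumed bounded; `|t| ^ q ≤ 1 + t ^ 2` for `q ≤ 2` passes to absolute
ones. -/
lemma DensityAssumption.momentFun (hg : DensityAssumption g x) (hg0 : ∀ s t, 0 ≤ g s t) {q : ℕ}
    (hq : q ≤ 2) : MomentFun g (fun t => t ^ q) where
  meas := by fun_prop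
  integrable := hg.moment_integrable q hq
  bdd := by
    obtain ⟨C0, hC0⟩ := hg.moment_bdd 0 (by norm_num)
    obtain ⟨C2, hC2⟩ := hg.moment_bdd 2 le_rfl
    refine ⟨C0 + C2, fun s => ?_⟩
    have i0 := hg.moment_integrable 0 (by norm_num) s
    have i2 := hg.moment_integrable 2 le_rfl s
    have i : Integrable (fun t => |t ^ q| * g s t) :=
      (hg.moment_integrable q hq s).abs.congr (Eventually.of_forall fun t => by
        simp only [abs_mul, abs_of_nonneg (hg0 s t)])
    rw [abs_of_nonneg (integral_nonneg fun t => mul_nonneg (abs_nonneg _) (hg0 s t))]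
    calc ∫ t, |t ^ q| * g s t ≤ ∫ t, (t ^ 0 * g s t + t ^ 2 * g s t) := by
          refine integral_mono i (i0.add i2) fun t => ?_
          simp only
          rw [← add_mul]
          refine mul_le_mul_of_nonneg_right ?_ (hg0 s t)
          interval_cases q
          · simp [sq_nonneg]
          · rw [pow_one, pow_zero, ← sq_abs t]
            nlinarith [sq_nonneg (|t| - 1), abs_nonneg t]
          · simp
      _ = moment g 0 s + moment g 2 s := integral_add i0 i2
      _ ≤ C0 + C2 := add_le_add ((le_abs_self _).trans (hC0 s)) ((le_abs_self _).trans (hC2 s))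

lemma DensityAssumption.momentFun_abs_pow_three (hg : DensityAssumption g x) :
    MomentFun g (fun t => |t| ^ 3) where
  meas := by fun_prop
  integrable s := by
    have := hg.absMoment_integrable 3 ⟨by norm_num, le_rfl⟩ s
    exact this.congr (Eventually.of_forall fun t => by norm_cast)
  bdd := by
    obtain ⟨C, hC⟩ := hg.absMoment_bdd 3 ⟨by norm_num, le_rfl⟩
    refine ⟨C, fun s => ?_⟩
    have e : ∫ t, |(|t| ^ 3)| * g s t = ∫ t, |t| ^ (3 : ℝ) * g s t := by
      refine integral_congr_ae (Eventually.of_forall fun t => ?_)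
      simp only
      rw [abs_of_nonneg (by positivity)]
      norm_cast
    simp only [e]
    exact hC s

end Density

section Kernel

variable {K : ℝ → ℝ}

lemma KernelAssumption.integrable_pow (hK : KernelAssumption K) (m : ℕ) :
    Integrable (fun z => K z ^ (m + 1)) := by
  obtain ⟨C, hC⟩ := hK.bdd
  have := hK.integrable.bdd_mul (c := C ^ m) (f := fun z => K z ^ m)
    (hK.cont.pow m).aestronglyMeasurable (Eventually.of_forall fun z => by
      rw [Real.norm_eq_abs, abs_pow]
      exact pow_le_pow_left₀ (abs_nonneg _) (hC z) m)
  exact this.congr (Eventually.of_forall fun z => by simp [pow_succ])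

end Kernel

namespace Sampling

variable {Ω : Type*} [MeasurableSpace Ω] {P : Measure Ω} {X Y : ℕ → Ω → ℝ}
  {g : ℝ → ℝ → ℝ} {φ L K : ℝ → ℝ} {x : ℝ}

lemma integrable (hS : Sampling P X Y g) (hφ : MomentFun g φ) (hL : Measurable L)
    (hLi : Integrable L) (k : ℕ) {H : ℝ} (hH : 0 < H) :
    Integrable (fun ω => φ (Y (k + 1) ω) * L (H⁻¹ * (x - X (k + 1) ω))) P := by
  have h1 := integrable_jointLaw hS.meas hS.nonneg hφ.meas hL hLi hφ.integrable hφ.bdd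
    (inv_pos.2 hH) x
  rw [← (hS.law k).map_eq] at h1
  exact h1.comp_aemeasurable (hS.law k).aemeasurable

lemma integral_eq (hS : Sampling P X Y g) (hφ : MomentFun g φ) (hL : Measurable L)
    (hLi : Integrable L) (k : ℕ) {H : ℝ} (hH : 0 < H) :
    ∫ ω, φ (Y (k + 1) ω) * L (H⁻¹ * (x - X (k + 1) ω)) ∂P =
      H * smooth L (fun s => ∫ t, φ t * g s t) x H := by
  have h1 := integrable_jointLaw hS.meas hS.nonneg hφ.meas hL hLi hφ.integrable hφ.bdd
    (inv_pos.2 hH) x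
  have h2 := integral_jointLaw hS.meas hS.nonneg hφ.meas hL hLi hφ.integrable hφ.bdd
    (inv_pos.2 hH) x
  rw [inv_inv] at h2
  exact ((hS.law k).integral_comp h1.aestronglyMeasurable).trans h2

lemma exists_integral_le (hS : Sampling P X Y g) (hφ : MomentFun g φ) (hL : Measurable L)
    (hLi : Integrable L) : ∃ C, 0 ≤ C ∧ ∀ (k : ℕ) (H : ℝ), 0 < H →
      ∫ ω, |φ (Y (k + 1) ω)| * L (H⁻¹ * (x - X (k + 1) ω)) ∂P ≤ H * C := by
  obtain ⟨C, hC⟩ := hφ.bdd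
  have hC0 : 0 ≤ C := (abs_nonneg _).trans (hC 0)
  refine ⟨C * ∫ z, |L z|, mul_nonneg hC0 (integral_nonneg fun _ => abs_nonneg _),
    fun k H hH => ?_⟩
  rw [hS.integral_eq (hφ.abs hS.nonneg) hL hLi k hH]
  exact mul_le_mul_of_nonneg_left ((le_abs_self _).trans (abs_smooth_le hLi hC x H)) hH.le

lemma aemeasurable_term (hS : Sampling P X Y g) (hK : KernelAssumption K) (k : ℕ) (H α β : ℝ) :
    AEMeasurable (fun ω => (α * Y (k + 1) ω - β) * K (H⁻¹ * (x - X (k + 1) ω))) P := by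
  have hKm := hK.cont.measurable
  have : Measurable fun p : ℝ × ℝ => (α * p.2 - β) * K (H⁻¹ * (x - p.1)) := by fun_prop
  exact this.comp_aemeasurable (hS.law k).aemeasurable

lemma integral_term (hS : Sampling P X Y g) (hK : KernelAssumption K) (hg : DensityAssumption g x)
    (k : ℕ) {H : ℝ} (hH : 0 < H) (α β : ℝ) :
    ∫ ω, (α * Y (k + 1) ω - β) * K (H⁻¹ * (x - X (k + 1) ω)) ∂P =
      H * (α * smooth K (moment g 1) x H - β * smooth K (moment g 0) x H) := by
  have hKm := hK.cont.measurable
  have f1 := hg.momentFun hS.nonneg (show 1 ≤ 2 by norm_num)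
  have f0 := hg.momentFun hS.nonneg (show 0 ≤ 2 by norm_num)
  have i1 := hS.integrable (x := x) f1 hKm hK.integrable k hH
  have i0 := hS.integrable (x := x) f0 hKm hK.integrable k hH
  have e1 := hS.integral_eq (x := x) f1 hKm hK.integrable k hH
  have e0 := hS.integral_eq (x := x) f0 hKm hK.integrable k hH
  have e : ∀ ω, (α * Y (k + 1) ω - β) * K (H⁻¹ * (x - X (k + 1) ω)) =
      α * (Y (k + 1) ω ^ 1 * K (H⁻¹ * (x - X (k + 1) ω))) -
      β * (Y (k + 1) ω ^ 0 * K (H⁻¹ * (x - X (k + 1) ω))) := by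
    intro ω; ring
  simp_rw [e]
  rw [integral_sub (i1.const_mul α) (i0.const_mul β), integral_const_mul, integral_const_mul, e1,
    e0]
  unfold moment
  ring

lemma integral_term_sq (hS : Sampling P X Y g) (hK : KernelAssumption K)
    (hg : DensityAssumption g x) (k : ℕ) {H : ℝ} (hH : 0 < H) (α β : ℝ) :
    ∫ ω, ((α * Y (k + 1) ω - β) * K (H⁻¹ * (x - X (k + 1) ω))) ^ 2 ∂P =
      H * (α ^ 2 * smooth (fun z => K z ^ 2) (moment g 2) x H
        - 2 * α * β * smooth (fun z => K z ^ 2) (moment g 1) x H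
        + β ^ 2 * smooth (fun z => K z ^ 2) (moment g 0) x H) := by
  have hKm : Measurable fun z => K z ^ 2 := hK.cont.measurable.pow_const 2
  have hKi := hK.integrable_pow 1
  have f2 := hg.momentFun hS.nonneg (le_refl 2)
  have f1 := hg.momentFun hS.nonneg (show 1 ≤ 2 by norm_num)
  have f0 := hg.momentFun hS.nonneg (show 0 ≤ 2 by norm_num)
  have i2 := hS.integrable (x := x) f2 hKm hKi k hH
  have i1 := hS.integrable (x := x) f1 hKm hKi k hH
  have i0 := hS.integrable (x := x) f0 hKm hKi k hH
  have e2 := hS.integral_eq (x := x) f2 hKm hKi k hH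
  have e1 := hS.integral_eq (x := x) f1 hKm hKi k hH
  have e0 := hS.integral_eq (x := x) f0 hKm hKi k hH
  have e : ∀ ω, ((α * Y (k + 1) ω - β) * K (H⁻¹ * (x - X (k + 1) ω))) ^ 2 =
      α ^ 2 * (Y (k + 1) ω ^ 2 * K (H⁻¹ * (x - X (k + 1) ω)) ^ 2) -
      2 * α * β * (Y (k + 1) ω ^ 1 * K (H⁻¹ * (x - X (k + 1) ω)) ^ 2) +
      β ^ 2 * (Y (k + 1) ω ^ 0 * K (H⁻¹ * (x - X (k + 1) ω)) ^ 2) := by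
    intro ω; ring
  simp_rw [e]
  have j : Integrable (fun ω => α ^ 2 * (Y (k + 1) ω ^ 2 * K (H⁻¹ * (x - X (k + 1) ω)) ^ 2) -
      2 * α * β * (Y (k + 1) ω ^ 1 * K (H⁻¹ * (x - X (k + 1) ω)) ^ 2)) P :=
    (i2.const_mul _).sub (i1.const_mul _)
  rw [integral_add j (i0.const_mul _), integral_sub (i2.const_mul _) (i1.const_mul _),
    integral_const_mul, integral_const_mul, integral_const_mul, e2, e1, e0]
  unfold moment
  ring

/-- The gain is the factor `H`, the width of the kernel window, with a constant independent of `k`,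
`H`, `α` and `β`. -/
lemma exists_integral_abs_term_le (hS : Sampling P X Y g) (hK : KernelAssumption K)
    (hg : DensityAssumption g x) : ∃ D, 0 ≤ D ∧ ∀ (k : ℕ) (H α β : ℝ), 0 < H →
      ∫ ω, |(α * Y (k + 1) ω - β) * K (H⁻¹ * (x - X (k + 1) ω))| ∂P ≤ H * (D * (|α| + |β|)) := by
  have hKm : Measurable fun z => |K z| := hK.cont.measurable.abs
  have hKi := hK.integrable.abs
  have f1 := hg.momentFun hS.nonneg (show 1 ≤ 2 by norm_num)
  have f0 := hg.momentFun hS.nonneg (show 0 ≤ 2 by norm_num)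
  obtain ⟨D1, hD1, h1⟩ := hS.exists_integral_le (x := x) f1 hKm hKi
  obtain ⟨D0, hD0, h0⟩ := hS.exists_integral_le (x := x) f0 hKm hKi
  refine ⟨D1 + D0, by positivity, fun k H α β hH => ?_⟩
  have i1 := hS.integrable (x := x) (f1.abs hS.nonneg) hKm hKi k hH
  have i0 := hS.integrable (x := x) (f0.abs hS.nonneg) hKm hKi k hH
  calc ∫ ω, |(α * Y (k + 1) ω - β) * K (H⁻¹ * (x - X (k + 1) ω))| ∂P
      ≤ ∫ ω, (|α| * (|Y (k + 1) ω ^ 1| * |K (H⁻¹ * (x - X (k + 1) ω))|) +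
        |β| * (|Y (k + 1) ω ^ 0| * |K (H⁻¹ * (x - X (k + 1) ω))|)) ∂P := by
        refine integral_mono_of_nonneg (Eventually.of_forall fun ω => abs_nonneg _)
          ((i1.const_mul _).add (i0.const_mul _)) (Eventually.of_forall fun ω => ?_)
        simp only [pow_one, pow_zero, abs_one, one_mul]
        rw [abs_mul]
        calc |α * Y (k + 1) ω - β| * |K (H⁻¹ * (x - X (k + 1) ω))|
            ≤ (|α * Y (k + 1) ω| + |β|) * |K (H⁻¹ * (x - X (k + 1) ω))| := by
              gcongr
              exact abs_sub _ _
          _ = _ := by rw [abs_mul]; ring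
    _ ≤ |α| * (H * D1) + |β| * (H * D0) := by
        rw [integral_add (i1.const_mul _) (i0.const_mul _), integral_const_mul, integral_const_mul]
        gcongr
        · exact h1 k H hH
        · exact h0 k H hH
    _ ≤ H * ((D1 + D0) * (|α| + |β|)) := by
        have := mul_nonneg hH.le (mul_nonneg (abs_nonneg α) hD0)
        have := mul_nonneg hH.le (mul_nonneg (abs_nonneg β) hD1)
        nlinarith

lemma abs_sub_pow_three_le (u v : ℝ) : |u - v| ^ 3 ≤ 4 * (|u| ^ 3 + |v| ^ 3) := by
  have h1 : |u - v| ≤ |u| + |v| := abs_sub _ _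
  have h2 : |u - v| ^ 3 ≤ (|u| + |v|) ^ 3 := by gcongr
  -- For `p = |u|`, `q = |v|`: `4 (p³ + q³) - (p + q)³ = 3 (p + q) (p - q)²`.
  nlinarith [mul_nonneg (add_nonneg (abs_nonneg u) (abs_nonneg v)) (sq_nonneg (|u| - |v|))]

lemma exists_integral_abs_term_pow_three_le (hS : Sampling P X Y g) (hK : KernelAssumption K)
    (hg : DensityAssumption g x) : ∃ D, 0 ≤ D ∧ ∀ (k : ℕ) (H α β : ℝ), 0 < H →
      Integrable (fun ω => |(α * Y (k + 1) ω - β) * K (H⁻¹ * (x - X (k + 1) ω))| ^ 3) P ∧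
      ∫ ω, |(α * Y (k + 1) ω - β) * K (H⁻¹ * (x - X (k + 1) ω))| ^ 3 ∂P ≤
        H * (D * (|α| ^ 3 + |β| ^ 3)) := by
  have hKm : Measurable fun z => |K z ^ 3| := (hK.cont.measurable.pow_const 3).abs
  have hKi := (hK.integrable_pow 2).abs
  have f3 := hg.momentFun_abs_pow_three
  have f0 := hg.momentFun hS.nonneg (show 0 ≤ 2 by norm_num)
  obtain ⟨D3, hD3, h3⟩ := hS.exists_integral_le (x := x) f3 hKm hKi
  obtain ⟨D0, hD0, h0⟩ := hS.exists_integral_le (x := x) f0 hKm hKi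
  refine ⟨4 * (D3 + D0), by positivity, fun k H α β hH => ?_⟩
  have i3 := hS.integrable (x := x) (f3.abs hS.nonneg) hKm hKi k hH
  have i0 := hS.integrable (x := x) (f0.abs hS.nonneg) hKm hKi k hH
  have hle : ∀ ω, |(α * Y (k + 1) ω - β) * K (H⁻¹ * (x - X (k + 1) ω))| ^ 3 ≤
      4 * |α| ^ 3 * (|(|Y (k + 1) ω| ^ 3)| * |K (H⁻¹ * (x - X (k + 1) ω)) ^ 3|) +
        4 * |β| ^ 3 * (|Y (k + 1) ω ^ 0| * |K (H⁻¹ * (x - X (k + 1) ω)) ^ 3|) := by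
    intro ω
    simp only [pow_zero, abs_one, one_mul, abs_pow, abs_abs]
    rw [abs_mul, mul_pow]
    calc |α * Y (k + 1) ω - β| ^ 3 * |K (H⁻¹ * (x - X (k + 1) ω))| ^ 3
        ≤ (4 * (|α * Y (k + 1) ω| ^ 3 + |β| ^ 3)) * |K (H⁻¹ * (x - X (k + 1) ω))| ^ 3 := by
          gcongr
          exact abs_sub_pow_three_le _ _
      _ = _ := by rw [abs_mul]; ring
  have iR := (i3.const_mul (4 * |α| ^ 3)).add (i0.const_mul (4 * |β| ^ 3))
  refine ⟨iR.mono' ((hS.aemeasurable_term hK k H α β).abs.pow_const 3).aestronglyMeasurable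
    (Eventually.of_forall fun ω => ?_), ?_⟩
  · rw [Real.norm_eq_abs, abs_of_nonneg (by positivity)]
    exact hle ω
  calc ∫ ω, |(α * Y (k + 1) ω - β) * K (H⁻¹ * (x - X (k + 1) ω))| ^ 3 ∂P
      ≤ _ := integral_mono_of_nonneg (Eventually.of_forall fun ω => by positivity) iR
        (Eventually.of_forall hle)
    _ ≤ 4 * |α| ^ 3 * (H * D3) + 4 * |β| ^ 3 * (H * D0) := by
        refine (integral_add (i3.const_mul _) (i0.const_mul _)).trans_le ?_
        rw [integral_const_mul, integral_const_mul]
        gcongr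
        · exact h3 k H hH
        · exact h0 k H hH
    _ ≤ H * (4 * (D3 + D0) * (|α| ^ 3 + |β| ^ 3)) := by
        have := mul_nonneg hH.le (mul_nonneg (pow_nonneg (abs_nonneg α) 3) hD0)
        have := mul_nonneg hH.le (mul_nonneg (pow_nonneg (abs_nonneg β) 3) hD3)
        nlinarith

end Sampling

lemma estR_eq_div {Ω : Type*} (K : ℝ → ℝ) (h : ℕ → ℝ) (X Y : ℕ → Ω → ℝ) (x : ℝ) (γ β : ℕ → ℝ) (n : ℕ) (ω : Ω) :
    estR K h X Y x γ β n ω = estA K h X Y x β n ω / estF K h X x γ n ω := by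
  unfold estR
  split_ifs with h0
  · rfl
  · rw [not_not.1 h0, div_zero]

/-! ### Limits of the row sums and asymptotic normality -/

section Main

variable {Ω : Type*} [MeasurableSpace Ω] {P : Measure Ω}
  {X Y : ℕ → Ω → ℝ} {g : ℝ → ℝ → ℝ} {K : ℝ → ℝ} {h : ℕ → ℝ} {a b c x : ℝ}

/-- The second order bias coefficient of the kernel estimator of the `q`-th moment function. -/
def momentBias (g : ℝ → ℝ → ℝ) (K : ℝ → ℝ) (q : ℕ) (x : ℝ) : ℝ :=
  iteratedDeriv 2 (moment g q) x / 2 * kerMu 2 K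

/-- The limiting mean of `√(n h_n) (a_n(x) - r(x) f_n(x))` for the stepsizes `b / n`, `1 / n`. -/
def limMean (g : ℝ → ℝ → ℝ) (K : ℝ → ℝ) (a b c x : ℝ) : ℝ :=
  √c * (b * momentBias g K 1 x / (b - (1 - a) / 2)) -
    regr g x * (√c * (1 * momentBias g K 0 x / (1 - (1 - a) / 2)))

/-- The limiting variance of `√(n h_n) (a_n(x) - r(x) f_n(x))` for the stepsizes `b / n`,
`1 / n`. -/
def limVar (g : ℝ → ℝ → ℝ) (K : ℝ → ℝ) (a b x : ℝ) : ℝ :=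
  b * b * (moment g 2 x * kerR K) / (b + b - (1 - a)) -
    2 * regr g x * (b * 1 * (moment g 1 x * kerR K) / (b + 1 - (1 - a))) +
    regr g x ^ 2 * (1 * 1 * (moment g 0 x * kerR K) / (1 + 1 - (1 - a)))

/-- The summands of `√(n h_n) (a_n(x) - r f_n(x))`. -/
def summand (K : ℝ → ℝ) (h : ℕ → ℝ) (X Y : ℕ → Ω → ℝ) (b r x : ℝ) (n k : ℕ) (ω : Ω) : ℝ :=
  (√((n : ℝ) * h n) * (h (k + 1))⁻¹ * wt b n k * Y (k + 1) ω -
    √((n : ℝ) * h n) * (h (k + 1))⁻¹ * wt 1 n k * r) * K ((h (k + 1))⁻¹ * (x - X (k + 1) ω))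

lemma Sampling.iIndepFun_term (hS : Sampling P X Y g) (hK : KernelAssumption K) (H α β : ℕ → ℝ) :
    iIndepFun (fun (k : ℕ) (ω : Ω) =>
      (α k * Y (k + 1) ω - β k) * K ((H k)⁻¹ * (x - X (k + 1) ω))) P := by
  have hKm := hK.cont.measurable
  exact hS.indep.comp (fun k (p : ℝ × ℝ) => (α k * p.2 - β k) * K ((H k)⁻¹ * (x - p.1)))
    fun k => by fun_prop

lemma Bandwidth.sq_sqrt (hB : Bandwidth h a c) (n : ℕ) : √((n : ℝ) * h n) ^ 2 = n * h n := by
  refine Real.sq_sqrt ?_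
  rcases n with _ | n
  · simp
  · have := hB.pos n
    positivity

lemma regr_mul_dens (hfx : 0 < dens g x) : regr g x * moment g 0 x = moment g 1 x :=
  div_mul_cancel₀ _ hfx.ne'

lemma tendsto_sum_integral_summand (hS : Sampling P X Y g) (hK : KernelAssumption K)
    (hg : DensityAssumption g x) (hB : Bandwidth h a c) (hfx : 0 < dens g x)
    (hf2 : TwiceDiffAt (moment g 0) x) (ha2 : TwiceDiffAt (moment g 1) x)
    (hb1 : b ≤ 1) (hb : 1 - a < 2 * b) :
    Tendsto (fun n => ∑ k ∈ Finset.range n, ∫ ω, summand K h X Y b (regr g x) x n k ω ∂P) atTop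
      (𝓝 (limMean g K a b c x)) := by
  have e1 : Tendsto (fun k => (smooth K (moment g 1) x (h (k + 1)) - moment g 1 x) /
      h (k + 1) ^ 2) atTop (𝓝 (momentBias g K 1 x)) :=
    tendsto_smooth_bias hK (measurable_moment hS.meas 1) (hg.moment_bdd 1 (by norm_num)) ha2
      hB.pos hB.tendsto_zero_succ
  have e0 : Tendsto (fun k => (smooth K (moment g 0) x (h (k + 1)) - moment g 0 x) /
      h (k + 1) ^ 2) atTop (𝓝 (momentBias g K 0 x)) :=
    tendsto_smooth_bias hK (measurable_moment hS.meas 0) (hg.moment_bdd 0 (by norm_num)) hf2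
      hB.pos hB.tendsto_zero_succ
  have l1 := hB.tendsto_sum_bias e1 hb
  have l0 := (hB.tendsto_sum_bias e0 (b := 1) (by linarith)).const_mul (regr g x)
  -- Since `r(x) f(x) = a(x)`, the leading terms leave `a(x) √(n h_n)` times the difference of the
  -- two total weights; both totals are compared with `1`.
  have lb := (hB.tendsto_sqrt_mul_one_sub_sum hb).const_mul (moment g 1 x)
  have lc := (hB.tendsto_sqrt_mul_one_sub_sum (b := 1) (by linarith)).const_mul (moment g 1 x)
  have l := (l1.sub l0).add (lc.sub lb)
  simp only [mul_zero, sub_zero, add_zero] at l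
  refine l.congr fun n => ?_
  have hs : ∀ d : ℝ, moment g 1 x * (√((n : ℝ) * h n) * (1 - ∑ k ∈ Finset.range n, wt d n k)) =
      moment g 1 x * √((n : ℝ) * h n) - ∑ k ∈ Finset.range n,
        moment g 1 x * √((n : ℝ) * h n) * wt d n k := by
    intro d
    rw [← Finset.mul_sum]
    ring
  rw [hs, hs, sub_sub_sub_cancel_left, Finset.mul_sum, ← Finset.sum_sub_distrib,
    ← Finset.sum_sub_distrib, ← Finset.sum_add_distrib]
  refine Finset.sum_congr rfl fun k _ => ?_
  have hH := hB.pos k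
  simp only [summand]
  rw [hS.integral_term hK hg k hH]
  field_simp
  linear_combination (wt 1 n k * √((n : ℝ) * h n)) * regr_mul_dens hfx

lemma tendsto_sum_integral_summand_sq (hS : Sampling P X Y g) (hK : KernelAssumption K)
    (hg : DensityAssumption g x) (hB : Bandwidth h a c) (hb : 1 - a < 2 * b) :
    Tendsto (fun n => ∑ k ∈ Finset.range n, ∫ ω, summand K h X Y b (regr g x) x n k ω ^ 2 ∂P) atTop
      (𝓝 (limVar g K a b x)) := by
  have ha := hB.mem
  have hQ : ∀ q ≤ 2, Tendsto (fun k => smooth (fun z => K z ^ 2) (moment g q) x (h (k + 1))) atTop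
      (𝓝 (moment g q x * kerR K)) := fun q hq =>
    tendsto_smooth (hK.integrable_pow 1) (measurable_moment hS.meas q) (hg.moment_bdd q hq)
      (hg.moment_cont q hq) hB.tendsto_zero_succ
  have l2 := hB.tendsto_sum_second (hQ 2 le_rfl) (b := b) (b' := b) (by linarith)
  have l1 := (hB.tendsto_sum_second (hQ 1 (by norm_num)) (b := b) (b' := 1)
    (by linarith [ha.1, ha.2])).const_mul (2 * regr g x)
  have l0 := (hB.tendsto_sum_second (hQ 0 (by norm_num)) (b := 1) (b' := 1)
    (by linarith [ha.1])).const_mul (regr g x ^ 2)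
  refine ((l2.sub l1).add l0).congr fun n => ?_
  rw [Finset.mul_sum, Finset.mul_sum, ← Finset.sum_sub_distrib, ← Finset.sum_add_distrib]
  refine Finset.sum_congr rfl fun k _ => ?_
  have hH := hB.pos k
  simp only [summand]
  rw [hS.integral_term_sq hK hg k hH]
  have hsq := hB.sq_sqrt n
  generalize √((n : ℝ) * h n) = s at hsq ⊢
  rw [← hsq]
  field_simp

lemma tendsto_sum_integral_abs_summand_pow_three (hS : Sampling P X Y g)
    (hK : KernelAssumption K) (hg : DensityAssumption g x) (hB : Bandwidth h a c) (hb0 : 0 ≤ b)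
    (hb1 : b ≤ 1) (hb : 1 - a < 2 * b) (r : ℝ) :
    Tendsto (fun n => ∑ k ∈ Finset.range n, ∫ ω, |summand K h X Y b r x n k ω| ^ 3 ∂P) atTop
      (𝓝 0) := by
  obtain ⟨D, hD, hbound⟩ := hS.exists_integral_abs_term_pow_three_le hK hg
  have l := ((hB.tendsto_sum_third hb).add
    ((hB.tendsto_sum_third (b := 1) (by linarith)).const_mul (|r| ^ 3))).const_mul D
  simp only [mul_zero, add_zero] at l
  refine squeeze_zero (fun n => Finset.sum_nonneg fun k _ => integral_nonneg fun ω => by positivity)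
    (fun n => ?_) l
  rw [Finset.mul_sum, ← Finset.sum_add_distrib, Finset.mul_sum]
  refine Finset.sum_le_sum fun k _ => ((hbound k _ _ _ (hB.pos k)).2).trans_eq ?_
  have hH := hB.pos k
  have w0 := wt_nonneg hb0 hb1 n k
  have w1 := wt_nonneg zero_le_one le_rfl n k
  rw [abs_mul _ r, abs_of_nonneg (a := √((n : ℝ) * h n) * (h (k + 1))⁻¹ * wt b n k)
    (by positivity), abs_of_nonneg (a := √((n : ℝ) * h n) * (h (k + 1))⁻¹ * wt 1 n k)
    (by positivity)]
  field_simp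

/-- Each first absolute moment carries a factor `h (k + 1)` that cancels the `(h (k + 1))⁻¹` of the
summand, so the squares lack the `(h (k + 1))⁻¹` of the second moments and their sum vanishes. -/
lemma tendsto_sum_integral_abs_summand_sq (hS : Sampling P X Y g)
    (hK : KernelAssumption K) (hg : DensityAssumption g x) (hB : Bandwidth h a c) (hb0 : 0 ≤ b)
    (hb1 : b ≤ 1) (hb : 1 - a < 2 * b) (r : ℝ) :
    Tendsto (fun n => ∑ k ∈ Finset.range n, (∫ ω, |summand K h X Y b r x n k ω| ∂P) ^ 2) atTop
      (𝓝 0) := by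
  obtain ⟨D, hD, hbound⟩ := hS.exists_integral_abs_term_le hK hg
  have l := ((hB.tendsto_sum_sq hb).add
    ((hB.tendsto_sum_sq (b := 1) (by linarith)).const_mul (r ^ 2))).const_mul (2 * D ^ 2)
  simp only [mul_zero, add_zero] at l
  refine squeeze_zero (fun n => Finset.sum_nonneg fun k _ => by positivity) (fun n => ?_) l
  rw [Finset.mul_sum, ← Finset.sum_add_distrib, Finset.mul_sum]
  refine Finset.sum_le_sum fun k _ => ?_
  have hH := hB.pos k
  have w0 := wt_nonneg hb0 hb1 n k
  have w1 := wt_nonneg zero_le_one le_rfl n k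
  have h1 : ∫ ω, |summand K h X Y b r x n k ω| ∂P ≤
      √((n : ℝ) * h n) * D * (wt b n k + wt 1 n k * |r|) := by
    refine (hbound k _ _ _ (hB.pos k)).trans_eq ?_
    rw [abs_mul _ r, abs_of_nonneg (a := √((n : ℝ) * h n) * (h (k + 1))⁻¹ * wt b n k)
      (by positivity), abs_of_nonneg (a := √((n : ℝ) * h n) * (h (k + 1))⁻¹ * wt 1 n k)
      (by positivity)]
    field_simp
  have h0 : 0 ≤ ∫ ω, |summand K h X Y b r x n k ω| ∂P := integral_nonneg fun ω => abs_nonneg _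
  calc (∫ ω, |summand K h X Y b r x n k ω| ∂P) ^ 2
      ≤ (√((n : ℝ) * h n) * D * (wt b n k + wt 1 n k * |r|)) ^ 2 := by gcongr
    _ = √((n : ℝ) * h n) ^ 2 * D ^ 2 * (wt b n k + wt 1 n k * |r|) ^ 2 := by ring
    _ ≤ √((n : ℝ) * h n) ^ 2 * D ^ 2 * (2 * (wt b n k ^ 2 + wt 1 n k ^ 2 * r ^ 2)) := by
        gcongr
        rw [← sq_abs r]
        nlinarith [sq_nonneg (wt b n k - wt 1 n k * |r|)]
    _ = _ := by rw [hB.sq_sqrt]; ring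

/-- It is a limit of sums of integrals of squares, so no sign analysis of the closed formula is
needed. -/
lemma limVar_nonneg (hS : Sampling P X Y g) (hK : KernelAssumption K)
    (hg : DensityAssumption g x) (hB : Bandwidth h a c) (hb : 1 - a < 2 * b) :
    0 ≤ limVar g K a b x :=
  ge_of_tendsto' (tendsto_sum_integral_summand_sq hS hK hg hB hb) fun _ =>
    Finset.sum_nonneg fun _ _ => integral_nonneg fun _ => sq_nonneg _

variable [IsProbabilityMeasure P]

/-- The asymptotic normality of `√(n h_n) (a_n(x) - r(x) f_n(x))`. -/
lemma tendstoInDistribution_sum_summand (hS : Sampling P X Y g) (hK : KernelAssumption K)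
    (hg : DensityAssumption g x) (hB : Bandwidth h a c) (hfx : 0 < dens g x)
    (hf2 : TwiceDiffAt (moment g 0) x) (ha2 : TwiceDiffAt (moment g 1) x)
    (hb0 : 0 ≤ b) (hb1 : b ≤ 1) (hb : 1 - a < 2 * b) :
    TendstoInDistribution
      (fun n ω => ∑ k ∈ Finset.range n, summand K h X Y b (regr g x) x n k ω) atTop id
      (fun _ => P) (gaussianReal (limMean g K a b c x) (limVar g K a b x).toNNReal) := by
  obtain ⟨D, -, hbound⟩ := hS.exists_integral_abs_term_pow_three_le hK hg
  exact tendstoInDistribution_sum_of_lyapunov (limVar_nonneg hS hK hg hB hb)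
    (fun _ k => hS.aemeasurable_term hK k _ _ _)
    (fun _ => hS.iIndepFun_term hK (fun k => h (k + 1)) _ _)
    (fun _ k => (hbound k _ _ _ (hB.pos k)).1)
    (tendsto_sum_integral_summand hS hK hg hB hfx hf2 ha2 hb1 hb)
    (tendsto_sum_integral_summand_sq hS hK hg hB hb)
    (tendsto_sum_integral_abs_summand_pow_three hS hK hg hB hb0 hb1 hb _)
    (tendsto_sum_integral_abs_summand_sq hS hK hg hB hb0 hb1 hb _)

/-- The consistency of the recursive density estimator. -/
lemma tendstoInMeasure_estF (hS : Sampling P X Y g) (hK : KernelAssumption K)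
    (hg : DensityAssumption g x) (hB : Bandwidth h a c) :
    TendstoInMeasure P (estF K h X x (fun n => (n : ℝ)⁻¹)) atTop (fun _ => dens g x) := by
  have h0 : (0 : ℕ) ≤ 2 := by norm_num
  obtain ⟨D, -, hbound⟩ := hS.exists_integral_abs_term_pow_three_le hK hg
  -- Casting `f_n` as the case `α = 0` reuses the moment formulas proved for `(α Y - β) K`.
  have he : estF K h X x (fun n => (n : ℝ)⁻¹) = fun n ω => ∑ k ∈ Finset.range n,
      (0 * Y (k + 1) ω - -(wt 1 n k * (h (k + 1))⁻¹)) *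
        K ((h (k + 1))⁻¹ * (x - X (k + 1) ω)) := by
    funext n ω
    rw [estF_eq_sum]
    exact Finset.sum_congr rfl fun k _ => by ring
  rw [he]
  have hA := tendsto_smooth hK.integrable (measurable_moment hS.meas 0) (hg.moment_bdd 0 h0)
    (hg.moment_cont 0 h0) hB.tendsto_zero_succ
  rw [hK.integral_eq_one, mul_one] at hA
  have hQ := tendsto_smooth (hK.integrable_pow 1) (measurable_moment hS.meas 0)
    (hg.moment_bdd 0 h0) (hg.moment_cont 0 h0) hB.tendsto_zero_succ
  refine tendstoInMeasure_sum (fun n k => hS.aemeasurable_term hK k _ _ _)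
    (fun n => hS.iIndepFun_term hK (fun k => h (k + 1)) _ _)
    (fun n k => (integrable_of_integrable_abs_pow_three (hS.aemeasurable_term hK k _ _ _)
      (hbound k _ _ _ (hB.pos k)).1).2) ?_ ?_
  · have l := (isDecay_wt 1).tendsto_sum one_pos (e := fun k => smooth K (moment g 0) x (h (k + 1)))
      (hA.congr fun n => ?_)
    · rw [div_one] at l
      refine l.congr fun n => Finset.sum_congr rfl fun k _ => ?_
      have hH := hB.pos k
      rw [hS.integral_term hK hg k hH]
      field_simp
      ring
    · have : (n : ℝ) + 1 ≠ 0 := by positivity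
      rw [wt_self]
      field_simp
  · refine (hB.tendsto_sum_wt_one_sq hQ).congr fun n => Finset.sum_congr rfl fun k _ => ?_
    have hH := hB.pos k
    rw [hS.integral_term_sq hK hg k hH]
    field_simp
    ring

/-- The asymptotic normality of the semi-recursive estimator with stepsizes `1 / n`, `b / n`. -/
theorem tendstoInDistribution_estR (hS : Sampling P X Y g) (hK : KernelAssumption K)
    (hg : DensityAssumption g x) (hB : Bandwidth h a c) (hfx : 0 < dens g x)
    (hf2 : TwiceDiffAt (moment g 0) x) (ha2 : TwiceDiffAt (moment g 1) x)
    (hb0 : 0 ≤ b) (hb1 : b ≤ 1) (hb : 1 - a < 2 * b) :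
    TendstoInDistribution
      (fun (n : ℕ) (ω : Ω) => √((n : ℝ) * h n) *
        (estR K h X Y x (fun n => (n : ℝ)⁻¹) (fun n => b * (n : ℝ)⁻¹) n ω - regr g x))
      atTop id (fun _ => P)
      (gaussianReal (limMean g K a b c x / dens g x)
        (limVar g K a b x / dens g x ^ 2).toNNReal) := by
  have hFm : ∀ n, AEMeasurable (estF K h X x (fun n => (n : ℝ)⁻¹) n) P := by
    intro n
    have := Finset.aemeasurable_fun_sum (Finset.range n) fun k _ =>
      (hS.aemeasurable_term (x := x) hK k (h (k + 1)) 0 (-1)).const_mul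
        (wt 1 n k * (h (k + 1))⁻¹)
    refine this.congr (Eventually.of_forall fun ω => ?_)
    simp only [estF_eq_sum]
    exact Finset.sum_congr rfl fun k _ => by ring
  have hAm : ∀ n, AEMeasurable (estA K h X Y x (fun n => b * (n : ℝ)⁻¹) n) P := by
    intro n
    have := Finset.aemeasurable_fun_sum (Finset.range n) fun k _ =>
      (hS.aemeasurable_term (x := x) hK k (h (k + 1)) 1 0).const_mul (wt b n k * (h (k + 1))⁻¹)
    refine this.congr (Eventually.of_forall fun ω => ?_)
    simp only [estA_eq_sum]
    exact Finset.sum_congr rfl fun k _ => by ring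
  refine tendstoInDistribution_div hfx (limVar_nonneg hS hK hg hB hb)
    (tendstoInDistribution_sum_summand hS hK hg hB hfx hf2 ha2 hb0 hb1 hb)
    (tendstoInMeasure_estF hS hK hg hB) hFm (fun n => ?_) fun n ω hF => ?_
  · simp only [estR_eq_div]
    exact (((hAm n).div (hFm n)).sub_const _).const_mul _
  · have hF0 : estF K h X x (fun n => (n : ℝ)⁻¹) n ω ≠ 0 := ((half_pos hfx).trans hF).ne'
    have hsum : ∑ k ∈ Finset.range n, summand K h X Y b (regr g x) x n k ω =
        √((n : ℝ) * h n) * (estA K h X Y x (fun n => b * (n : ℝ)⁻¹) n ω -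
          regr g x * estF K h X x (fun n => (n : ℝ)⁻¹) n ω) := by
      rw [estA_eq_sum, estF_eq_sum, Finset.mul_sum, ← Finset.sum_sub_distrib, Finset.mul_sum]
      exact Finset.sum_congr rfl fun k _ => by simp only [summand]; ring
    rw [hsum, estR_eq_div, eq_div_iff hF0, mul_assoc, sub_mul, div_mul_cancel₀ _ hF0]

/-! ### Identification of the limiting constants -/

/-- For `c = 0` both sides are zero whatever the denominators. Otherwise `a = 1 / 5`, where `1 - (1
- a) / 2` and `1 - 2 a` are both `3 / 5`. -/
lemma limMean_one_div (hB : Bandwidth h a c) (hfx : 0 < dens g x) :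
    limMean g K a 1 c x / dens g x = √c * biasB g K a 1 x := by
  rcases eq_or_ne c 0 with rfl | hc
  · simp [limMean]
  · have := hB.eq_one_fifth hc
    subst this
    unfold limMean biasB momentBias regrDens
    change _ / dens g x = √c * (1 / (2 * dens g x) *
      (iteratedDeriv 2 (moment g 1) x / (1 - 2 * (1 / 5) * 1) -
        regr g x * iteratedDeriv 2 (moment g 0) x / (1 - 2 * (1 / 5))) * kerMu 2 K)
    field_simp
    ring

/-- As for `b = 1`; at `a = 1 / 5` the factor `b / (b - (1 - a) / 2) = 2` matches `1 - 2 a / (1 - a)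
= 1 / 2`. -/
lemma limMean_one_sub_div (hB : Bandwidth h a c) (hfx : 0 < dens g x) :
    limMean g K a (1 - a) c x / dens g x = √c * biasB g K a (1 - a)⁻¹ x := by
  rcases eq_or_ne c 0 with rfl | hc
  · simp [limMean]
  · have := hB.eq_one_fifth hc
    subst this
    unfold limMean biasB momentBias regrDens
    change _ / dens g x = √c * (1 / (2 * dens g x) *
      (iteratedDeriv 2 (moment g 1) x / (1 - 2 * (1 / 5) * (1 - 1 / 5)⁻¹) -
        regr g x * iteratedDeriv 2 (moment g 0) x / (1 - 2 * (1 / 5))) * kerMu 2 K)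
    norm_num
    field_simp
    ring

lemma limVar_one_div (hB : Bandwidth h a c) (hfx : 0 < dens g x) :
    limVar g K a 1 x / dens g x ^ 2 = varV g K a 1 1 x := by
  have ha := hB.mem.1
  have h1 := regr_mul_dens hfx
  have hf : moment g 0 x = dens g x := rfl
  rw [hf] at h1
  unfold limVar varV condMoment
  rw [hf, ← h1]
  have h2 : 1 + a ≠ 0 := by positivity
  rw [show (1 : ℝ) + 1 - (1 - a) = 1 + a by ring, show 2 - (1 - a) * 1 = 1 + a by ring,
    mul_one a]
  field_simp
  ring

lemma limVar_one_sub_div (hB : Bandwidth h a c) (hfx : 0 < dens g x) :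
    limVar g K a (1 - a) x / dens g x ^ 2 = (1 - a) * varV g K a (1 - a)⁻¹ 1 x := by
  have ha := hB.mem.1
  have ha1 : 1 - a ≠ 0 := (sub_pos.2 hB.mem.2).ne'
  have h1 := regr_mul_dens hfx
  have hf : moment g 0 x = dens g x := rfl
  rw [hf] at h1
  unfold limVar varV condMoment
  rw [hf, ← h1]
  have h2 : 1 + a ≠ 0 := by positivity
  -- With `ξ = (1 - a)⁻¹` this makes `2 ξ / (1 + a ξ) = 2`, matching the cross term, whose exponent
  -- is `b + 1 - (1 - a) = 1`.
  have h3 : 1 + a * (1 - a)⁻¹ = (1 - a)⁻¹ := by field_simp; ring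
  rw [show (1 : ℝ) + 1 - (1 - a) = 1 + a by ring, show 1 - a + 1 - (1 - a) = 1 by ring,
    show 1 - a + (1 - a) - (1 - a) = 1 - a by ring, h3, mul_inv_cancel₀ ha1]
  norm_num
  field_simp
  ring

end Main

end SemiRec

end

theorem corollary1 {Ω : Type*} [MeasurableSpace Ω] (P : Measure Ω) [IsProbabilityMeasure P]
    (X Y : ℕ → Ω → ℝ) (g : ℝ → ℝ → ℝ) (K : ℝ → ℝ) (h : ℕ → ℝ) (a x c : ℝ)
    -- `g` is a density on `ℝ × ℝ`; the pairs `(Xₙ, Yₙ)`, `n ≥ 1`, are i.i.d. with density `g`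
    (hg_meas : Measurable (Function.uncurry g)) (hg_nonneg : ∀ s t, 0 ≤ g s t)
    (hindep : iIndepFun (fun (k : ℕ) (ω : Ω) => (X (k + 1) ω, Y (k + 1) ω)) P)
    (hlaw : ∀ k : ℕ, HasLaw (fun ω => (X (k + 1) ω, Y (k + 1) ω))
      ((volume : Measure (ℝ × ℝ)).withDensity (fun p => ENNReal.ofReal (g p.1 p.2))) P)
    (hK : SemiRec.KernelAssumption K)
    (ha : a ∈ Set.Ioo (0 : ℝ) 1) (hh : SemiRec.GS (-a) h)
    (hg : SemiRec.DensityAssumption g x)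
    (hfx : 0 < SemiRec.dens g x)
    (hf2 : SemiRec.TwiceDiffAt (SemiRec.dens g) x)
    (ha2 : SemiRec.TwiceDiffAt (SemiRec.regrDens g) x)
    (hc : 0 ≤ c)
    (hlim : Tendsto (fun n : ℕ => (n : ℝ) * h n ^ 5) atTop (𝓝 c)) :
    (0 ≤ SemiRec.varV g K a 1 1 x ∧
      TendstoInDistribution
        (fun (n : ℕ) (ω : Ω) => √((n : ℝ) * h n) *
          (SemiRec.estR K h X Y x (fun n => (n : ℝ)⁻¹) (fun n => (n : ℝ)⁻¹) n ω
            - SemiRec.regr g x))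
        atTop id (fun _ => P)
        (gaussianReal (√c * SemiRec.biasB g K a 1 x)
          (SemiRec.varV g K a 1 1 x).toNNReal)) ∧
    (0 ≤ SemiRec.varV g K a (1 - a)⁻¹ 1 x ∧
      TendstoInDistribution
        (fun (n : ℕ) (ω : Ω) => √((n : ℝ) * h n) *
          (SemiRec.estR K h X Y x (fun n => (n : ℝ)⁻¹) (fun n => (1 - a) * (n : ℝ)⁻¹) n ω
            - SemiRec.regr g x))
        atTop id (fun _ => P)
        (gaussianReal (√c * SemiRec.biasB g K a (1 - a)⁻¹ x)
          ((1 - a) * SemiRec.varV g K a (1 - a)⁻¹ 1 x).toNNReal)) := by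
  have hS : SemiRec.Sampling P X Y g := ⟨hg_meas, hg_nonneg, hindep, hlaw⟩
  have hB : SemiRec.Bandwidth h a c := ⟨ha, hh, hc, hlim⟩
  have ha0 : 0 < 1 - a := sub_pos.2 ha.2
  have e1 := SemiRec.limVar_one_div (g := g) (K := K) hB hfx
  have e2 := SemiRec.limVar_one_sub_div (g := g) (K := K) hB hfx
  have hV1 := SemiRec.limVar_nonneg hS hK hg hB (b := 1) (by linarith [ha.1])
  have hV2 := SemiRec.limVar_nonneg hS hK hg hB (b := 1 - a) (by linarith)
  refine ⟨⟨?_, ?_⟩, ?_, ?_⟩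
  · rw [← e1]
    positivity
  · have := SemiRec.tendstoInDistribution_estR hS hK hg hB hfx hf2 ha2 (b := 1) zero_le_one le_rfl
      (by linarith [ha.1])
    rw [SemiRec.limMean_one_div hB hfx, e1] at this
    simpa only [one_mul] using this
  · refine nonneg_of_mul_nonneg_right ?_ ha0
    rw [← e2]
    positivity
  · have := SemiRec.tendstoInDistribution_estR hS hK hg hB hfx hf2 ha2 (b := 1 - a) ha0.le
      (by linarith [ha.1]) (by linarith)
    rw [SemiRec.limMean_one_sub_div hB hfx, e2] at this
    exact this
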